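/- **Setting.** Let $n$ sites be placed at distinct points of $\mathbb Z^D$ (with the Euclidean distance $d$), and let $\gamma_1,\dots,\gamma_{2n}$ be self-adjoint Majorana operators, $\{\gamma_j,\gamma_k\}=2\delta_{jk}$, on the $2^n$-dimensional space $\mathcal H$, where $\gamma_{2a-1},\gamma_{2a}$ live on the $a$-th site. An operator $W$ on $\mathcal H$ is $(\xi,r_0)$-geometrically local if $W=\sum_x W_x$, the sum running over the sites, where $\|W_x\|\le\xi$ and $W_x$ lies in the algebra generated by the Majorana operators on sites at distance at most $r_0$ from $x$. Let $H_0=\sum_{j,k}h_{jk}\gamma_j\gamma_k$ be self-adjoint and let $\beta>0$. Let $\mathcal H'$ have orthonormal basis $(v_\alpha)_{\alpha\in\{0,1\}^{2n}}$, let $\varphi:B(\mathcal H)\to\mathcal H'$ be the linear map with $\varphi(\gamma_1^{\alpha_1}\cdots\gamma_{2n}^{\alpha_{2n}})=v_\alpha$, and let $(-1)^{\hat n}v_\alpha=(-1)^{|\alpha|}v_\alpha$. Write $L_AX=AX$, $R_AX=XA$. Let $\Phi:B(B(\mathcal H))\to B(\mathcal H')$ be the linear map with $\Phi(L_WR_{W'})=\Phi(L_W)\Phi(R_{W'})$,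 $\Phi(L_W)=\varphi L_W\varphi^{-1}$, and $\Phi(R_{W'})=\varphi R_{W'}\varphi^{-1}$ if $W'$ is even, $\Phi(R_{W'})=\varphi R_{W'}\varphi^{-1}(-1)^{\hat n}$ if $W'$ is odd in the Majorana operators. Put $\gamma_j(t)=e^{iH_0t}\gamma_je^{-iH_0t}$ and $$f(t)=\frac{e^{-t^2/\beta^2}}{\sqrt{\beta\sqrt{\pi/2}}},\quad \eta(\omega)=e^{-(\beta\omega+1)^2/2},\quad b_1(t)=2\sqrt\pi\,e^{1/8}\int_{\mathbb R}\frac{\sin(-(t-s))\,e^{-2(t-s)^2}}{\cosh(2\pi s)}\,ds,\quad b_2(t)=\frac{e^{-4t^2-2it}}{2\pi^{3/2}},$$ $$\tilde A_j(\omega)=e^{-\beta H_0/4}\Big(\tfrac1{\sqrt{2\pi}}\int_{\mathbb R}\gamma_j(t)f(t)e^{-i\omega t}dt\Big)e^{\beta H_0/4},$$ $$\tilde B_j=e^{-\beta H_0/4}\int_{\mathbb R}dt\,b_1(t)\int_{\mathbb R}dt'\,b_2(t')\,\gamma_j(\beta(t'-t))\,\gamma_j(-\beta(t+t'))\;e^{\beta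 H_0/4}.$$ The free parent Hamiltonian is $$H_0^{\mathrm{parent}}=\Phi\Big(i\sum_j(L_{\tilde B_j}-R_{\tilde B_j^\dagger})+\sum_j\int_{\mathbb R}\eta(\omega)\big(L_{\tilde A_j(-\omega)}R_{\tilde A_j(-\omega)^\dagger}-\tfrac12L_{\tilde A_j(-\omega)\tilde A_j(\omega)}-\tfrac12R_{\tilde A_j(\omega)^\dagger\tilde A_j(-\omega)^\dagger}\big)d\omega\Big).$$ **Proposition.** There is a universal constant $C>0$ such that for all $D\in\mathbb N$ and $\beta,r_0>0$ there is a constant $\Delta>0$, depending only on $\beta,r_0,D$, with the following property. For every $n$, every placement of the sites and every self-adjoint quadratic $H_0$ that is $(1,r_0)$-geometrically local, $H_0^{\mathrm{parent}}$ is self-adjoint, $0$ is a non-degenerate eigenvalue of it, and every other eigenvalue is at most $-\Delta$; so $0$ is the top eigenvalue and the spectral gap below it is at least $\Delta$. Moreover, if $n\ge1$, then the gap between $0$ and the second largest eigenvalue equals $$\min_k\;C\,e^{-4\beta^2\varepsilon_k^2}\cosh(2\beta\varepsilon_k),$$ where the $\varepsilon_k$ run over the eigenvalues of $\tfrac12(h-h^{\mathsf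 T})$ (this matrix is $h$ itself when $h$ is Hermitian and purely imaginary). -/

import Mathlib

open MeasureTheory

noncomputable section

namespace FreeFermion

/-! ### Fermionic modes and Majorana operators -/

/-- The Hilbert space of `n` Dirac fermion modes, of dimension `2 ^ n`. -/
def Fock (n : ℕ) : Type := EuclideanSpace ℂ (Fin n → Fin 2)

instance (n : ℕ) : NormedAddCommGroup (Fock n) :=
  inferInstanceAs (NormedAddCommGroup (EuclideanSpace ℂ (Fin n → Fin 2)))

instance (n : ℕ) : InnerProductSpace ℂ (Fock n) :=
  inferInstanceAs (InnerProductSpace ℂ (EuclideanSpace ℂ (Fin n → Fin 2)))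

instance (n : ℕ) : FiniteDimensional ℂ (Fock n) :=
  inferInstanceAs (FiniteDimensional ℂ (EuclideanSpace ℂ (Fin n → Fin 2)))

instance (n : ℕ) : CompleteSpace (Fock n) :=
  inferInstanceAs (CompleteSpace (EuclideanSpace ℂ (Fin n → Fin 2)))

/-- The standard orthonormal basis of `Fock n`. -/
def stdBasis (n : ℕ) : OrthonormalBasis (Fin n → Fin 2) ℂ (Fock n) :=
  EuclideanSpace.basisFun (Fin n → Fin 2) ℂ

/-- The operator algebra `B(H)`, with the operator norm; `star` is the adjoint. -/
abbrev Op (n : ℕ) : Type := Fock n →L[ℂ] Fock n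

/-- The algebra `B(B(H))` of super-operators. -/
abbrev SuperOp (n : ℕ) : Type := Op n →L[ℂ] Op n

/-- `γ 0, …, γ (2n - 1)` are Majorana operators: they are self-adjoint and satisfy the canonical
anti-commutation relations `{γ j, γ k} = 2 δ_{jk}`. -/
structure IsMajorana {n : ℕ} (γ : Fin (2 * n) → Op n) : Prop where
  selfAdjoint : ∀ j, star (γ j) = γ j
  anticomm : ∀ j k, γ j * γ k + γ k * γ j = if j = k then 2 else 0

/-- The ordered product `γ_1 ^ α_1 γ_2 ^ α_2 ⋯ γ_{2n} ^ α_{2n}`. -/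
def monomial {n : ℕ} (γ : Fin (2 * n) → Op n) (α : Fin (2 * n) → Fin 2) : Op n :=
  (List.ofFn fun j => γ j ^ (α j : ℕ)).prod

/-- The degree `|α|`. -/
def degree {m : ℕ} (α : Fin m → Fin 2) : ℕ := ∑ j, (α j : ℕ)

/-- The quadratic operator `∑_{jk} h_{jk} γ_j γ_k`. -/
def quadratic {n : ℕ} (γ : Fin (2 * n) → Op n)
    (h : Matrix (Fin (2 * n)) (Fin (2 * n)) ℂ) : Op n :=
  ∑ j, ∑ k, h j k • (γ j * γ k)

/-! ### Geometry -/

/-- The Euclidean distance on the cubic lattice `ℤ ^ D`. -/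
def latticeDist {D : ℕ} (x y : Fin D → ℤ) : ℝ := √(∑ i, ((x i : ℝ) - (y i : ℝ)) ^ 2)

/-- The index of the site that carries the Majorana mode `j`: the modes `2a` and `2a + 1`
(counted from zero) live on the `a`-th site. -/
def siteIndex {n : ℕ} (j : Fin (2 * n)) : Fin n := ⟨(j : ℕ) / 2, by omega⟩

/-- `W` is supported on a set of sites when it is in the algebra generated by
the Majorana operators of these sites. -/
def SupportedOn {n : ℕ} (γ : Fin (2 * n) → Op n) (S : Set (Fin n)) (W : Op n) : Prop :=
  W ∈ Algebra.adjoin ℂ (γ '' {j | siteIndex j ∈ S})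

/-- `W` is `(ξ, r₀)`-geometrically local: it is a sum, over the balls of radius `r₀` (centred at
the sites of the lattice), of operators of norm at most `ξ` supported on these balls. -/
def GeometricallyLocal {n D : ℕ} (γ : Fin (2 * n) → Op n) (site : Fin n → Fin D → ℤ)
    (ξ r₀ : ℝ) (W : Op n) : Prop :=
  ∃ w : Fin n → Op n, W = ∑ a, w a ∧
    ∀ a, SupportedOn γ {b | latticeDist (site a) (site b) ≤ r₀} (w a) ∧ ‖w a‖ ≤ ξ

/-! ### Third quantization -/

/-- The enlarged Hilbert space `H'` of `2n` modes. -/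
abbrev Fock' (n : ℕ) : Type := Fock (2 * n)

/-- The operator algebra `B(H')`. -/
abbrev Op' (n : ℕ) : Type := Op (2 * n)

/-- The orthonormal basis `v_α`, `α ∈ {0,1}^{2n}`, of `H'`. -/
def vec {n : ℕ} (α : Fin (2 * n) → Fin 2) : Fock' n := stdBasis (2 * n) α

/-- The coefficient of `γ_1 ^ α_1 ⋯ γ_{2n} ^ α_{2n}` in the expansion of `X ∈ B(H)` into ordered
products of Majorana operators, `2⁻ⁿ Tr ((γ_1 ^ α_1 ⋯ γ_{2n} ^ α_{2n})† X)`. -/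
def coeff {n : ℕ} (γ : Fin (2 * n) → Op n) (α : Fin (2 * n) → Fin 2) : Op n →ₗ[ℂ] ℂ where
  toFun X := ((2 : ℂ) ^ n)⁻¹ * LinearMap.trace ℂ (Fock n) (star (monomial γ α) * X : Op n)
  map_add' X Y := by rw [mul_add, ContinuousLinearMap.toLinearMap_add, map_add, mul_add]
  map_smul' c X := by
    rw [mul_smul_comm, ContinuousLinearMap.toLinearMap_smul, map_smul, smul_eq_mul, smul_eq_mul,
      RingHom.id_apply, mul_left_comm]

/-- The linear map `φ : B(H) → H'` with `φ (γ_1 ^ α_1 ⋯ γ_{2n} ^ α_{2n}) = v_α`;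
see `phi_monomial`. -/
def phi {n : ℕ} (γ : Fin (2 * n) → Op n) : Op n →L[ℂ] Fock' n :=
  LinearMap.toContinuousLinearMap (∑ α, (coeff γ α).smulRight (vec α))

/-- The inverse map `φ⁻¹ : H' → B(H)`, `∑ x_α v_α ↦ ∑ x_α γ_1 ^ α_1 ⋯ γ_{2n} ^ α_{2n}`. -/
def phiInv {n : ℕ} (γ : Fin (2 * n) → Op n) : Fock' n →L[ℂ] Op n :=
  ∑ α, (innerSL ℂ (vec α)).smulRight (monomial γ α)

/-- The parity operator `(-1) ^ n̂` on `H'`, i.e. `v_α ↦ (-1) ^ |α| v_α`. -/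
def parity' (n : ℕ) : Op' n :=
  ∑ α : Fin (2 * n) → Fin 2, (-1 : ℂ) ^ degree α • InnerProductSpace.rankOne ℂ (vec α) (vec α)

/-- Left multiplication `L_A X = A X`. -/
def leftMul {n : ℕ} (A : Op n) : SuperOp n := ContinuousLinearMap.mul ℂ (Op n) A

/-- Right multiplication `R_A X = X A`. -/
def rightMul {n : ℕ} (A : Op n) : SuperOp n := (ContinuousLinearMap.mul ℂ (Op n)).flip A

/-- The representation `φ ∘ 𝒳 ∘ φ⁻¹` of a super-operator on `H'`. -/
def rep {n : ℕ} (γ : Fin (2 * n) → Op n) (X : SuperOp n) : Op' n := phi γ ∘L X ∘L phiInv γ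

/-- The even part of an operator: the part spanned by monomials of even degree. -/
def evenPart {n : ℕ} (γ : Fin (2 * n) → Op n) (W : Op n) : Op n :=
  ∑ α with Even (degree α), coeff γ α W • monomial γ α

/-- The odd part of an operator: the part spanned by monomials of odd degree. -/
def oddPart {n : ℕ} (γ : Fin (2 * n) → Op n) (W : Op n) : Op n :=
  ∑ α with Odd (degree α), coeff γ α W • monomial γ α

/-- `Φ(R_W)`: it is `φ ∘ R_W ∘ φ⁻¹` for even `W`, and `(φ ∘ R_W ∘ φ⁻¹) (-1) ^ n̂` for odd `W`. -/
def PhiRight {n : ℕ} (γ : Fin (2 * n) → Op n) (W : Op n) : Op' n :=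
  rep γ (rightMul (evenPart γ W)) + rep γ (rightMul (oddPart γ W)) * parity' n

/-- The matrix unit `|s⟩⟨t|`. -/
def matUnit {n : ℕ} (s t : Fin n → Fin 2) : Op n :=
  InnerProductSpace.rankOne ℂ (stdBasis n s) (stdBasis n t)

/-- The linear map `Φ : B(B(H)) → B(H')` determined by `Φ(L_W R_{W'}) = Φ(L_W) Φ(R_{W'})` and
`Φ(L_W) = φ ∘ L_W ∘ φ⁻¹` (see `Phi_leftMul_rightMul`). It is written out on the expansion
`𝒳 = ∑_{stuv} ⟨s| 𝒳(|t⟩⟨u|) |v⟩ L_{|s⟩⟨t|} R_{|u⟩⟨v|}` of a super-operator. -/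
def Phi {n : ℕ} (γ : Fin (2 * n) → Op n) (X : SuperOp n) : Op' n :=
  ∑ s, ∑ t, ∑ u, ∑ v, inner ℂ (stdBasis n s) (X (matUnit t u) (stdBasis n v)) •
    (rep γ (leftMul (matUnit s t)) * PhiRight γ (matUnit u v))

/-! ### The filter functions -/

/-- The filter function `f`. -/
def filterF (β t : ℝ) : ℝ := 1 / √(β * √(Real.pi / 2)) * Real.exp (-t ^ 2 / β ^ 2)

/-- The transition weight `η`. -/
def eta (β ω : ℝ) : ℝ := Real.exp (-(β * ω + 1) ^ 2 / 2)

/-- The function `b₁`, a convolution of `1 / cosh (2 π t)` and `sin (-t) exp (-2 t ^ 2)`. -/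
def b₁ (t : ℝ) : ℝ :=
  2 * √Real.pi * Real.exp (1 / 8) *
    ∫ s : ℝ, 1 / Real.cosh (2 * Real.pi * s) * (Real.sin (-(t - s)) * Real.exp (-2 * (t - s) ^ 2))

/-- The function `b₂`. -/
def b₂ (t : ℝ) : ℂ :=
  1 / (2 * Real.pi ^ (3 / 2 : ℝ) : ℝ) * Complex.exp (-4 * (t : ℂ) ^ 2 - 2 * Complex.I * t)

/-! ### The parent Hamiltonian of a Hamiltonian `K` at inverse temperature `β` -/

/-- The Heisenberg evolution `W(t) = exp (i K t) W exp (- i K t)`. -/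
def heisenberg {n : ℕ} (K W : Op n) (t : ℝ) : Op n :=
  NormedSpace.exp ((Complex.I * (t : ℂ)) • K) * W * NormedSpace.exp ((-Complex.I * (t : ℂ)) • K)

/-- Conjugation `σ^{1/4} W σ^{-1/4}` by the Gibbs state `σ ∝ exp (- β K)`. -/
def gibbsConj {n : ℕ} (β : ℝ) (K W : Op n) : Op n :=
  NormedSpace.exp ((-(β : ℂ) / 4) • K) * W * NormedSpace.exp (((β : ℂ) / 4) • K)

/-- The conjugated jump operators `Ã_j(ω)`. -/
def jumpTilde {n : ℕ} (γ : Fin (2 * n) → Op n) (β : ℝ) (K : Op n) (j : Fin (2 * n)) (ω : ℝ) :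
    Op n :=
  gibbsConj β K ((1 / √(2 * Real.pi) : ℝ) •
    ∫ t : ℝ, ((filterF β t : ℂ) * Complex.exp (-Complex.I * ω * t)) • heisenberg K (γ j) t)

/-- The conjugated coherent terms `B̃_j`. -/
def coherentTilde {n : ℕ} (γ : Fin (2 * n) → Op n) (β : ℝ) (K : Op n) (j : Fin (2 * n)) : Op n :=
  gibbsConj β K (∫ t : ℝ, b₁ t • ∫ t' : ℝ, b₂ t' •
    (heisenberg K (γ j) (β * (t' - t)) * heisenberg K (γ j) (-β * (t + t'))))

/-- The coherent part of the parent Hamiltonian. -/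
def parentC {n : ℕ} (γ : Fin (2 * n) → Op n) (β : ℝ) (K : Op n) : Op' n :=
  Phi γ (Complex.I • ∑ j,
    (leftMul (coherentTilde γ β K j) - rightMul (star (coherentTilde γ β K j))))

/-- The dissipative part of the parent Hamiltonian. -/
def parentD {n : ℕ} (γ : Fin (2 * n) → Op n) (β : ℝ) (K : Op n) : Op' n :=
  Phi γ (∑ j, ∫ ω : ℝ, eta β ω •
    (leftMul (jumpTilde γ β K j (-ω)) * rightMul (star (jumpTilde γ β K j (-ω)))
      - (1 / 2 : ℝ) • leftMul (jumpTilde γ β K j (-ω) * jumpTilde γ β K j ω)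
      - (1 / 2 : ℝ) • rightMul (star (jumpTilde γ β K j ω) * star (jumpTilde γ β K j (-ω)))))

/-- The parent Hamiltonian, the sum of the coherent and the dissipative part. -/
def parentHamiltonian {n : ℕ} (γ : Fin (2 * n) → Op n) (β : ℝ) (K : Op n) : Op' n :=
  parentC γ β K + parentD γ β K

/-- The free parent Hamiltonian `H₀^parent` of `H₀ = ∑_{jk} h_{jk} γ_j γ_k`. -/
def freeParent {n : ℕ} (γ : Fin (2 * n) → Op n) (β : ℝ)
    (h : Matrix (Fin (2 * n)) (Fin (2 * n)) ℂ) : Op' n :=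
  parentHamiltonian γ β (quadratic γ h)

/-! ### Single-particle data -/

/-- `ε` is a single-particle energy of `∑_{jk} h_{jk} γ_j γ_k`: an eigenvalue of the antisymmetric
part of `h`, which is `h` itself when `h` is Hermitian and purely imaginary. -/
def IsSingleParticleEnergy {n : ℕ} (h : Matrix (Fin (2 * n)) (Fin (2 * n)) ℂ) (ε : ℝ) : Prop :=
  Module.End.HasEigenvalue (Matrix.toLin' ((1 / 2 : ℂ) • (h - h.transpose))) (ε : ℂ)

/-- `C exp (- 4 β² ε²) cosh (2 β ε)`, the gap of a single mode of energy `ε`. -/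
def singleModeGap (C β ε : ℝ) : ℝ :=
  C * Real.exp (-4 * β ^ 2 * ε ^ 2) * Real.cosh (2 * β * ε)

/-! ### The defining properties of `φ` and `Φ`, and existence of Majorana operators -/

section
variable {n : ℕ} {γ : Fin (2 * n) → Op n}

theorem IsMajorana.sq (hγ : IsMajorana γ) (j : Fin (2 * n)) : γ j * γ j = 1 := by
  have h := hγ.anticomm j j
  rw [if_pos rfl, ← two_mul] at h
  have h2 : (2 : ℂ) • (γ j * γ j) = (2 : ℂ) • (1 : Op n) := by
    rw [two_smul, two_smul, ← two_mul, h]; norm_num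
  exact smul_right_injective (Op n) two_ne_zero h2

/-- The sign picked up when `γ_j` is moved through a monomial. -/
def moveSign (j : Fin (2 * n)) (α : Fin (2 * n) → Fin 2) : ℂ :=
  ∏ k, if k = j then 1 else (-1) ^ (α k : ℕ)

theorem moveSign_eq (j : Fin (2 * n)) (α : Fin (2 * n) → Fin 2) :
    moveSign j α = (-1) ^ (degree α + (α j : ℕ)) := by
  have h1 : ∀ k, (if k = j then 1 else (-1 : ℂ) ^ (α k : ℕ))
      = (-1) ^ (α k : ℕ) * (if k = j then (-1) ^ (α k : ℕ) else 1) := by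
    intro k
    split_ifs
    · rw [← mul_pow]; simp
    · simp
  rw [moveSign, Finset.prod_congr rfl fun k _ => h1 k, Finset.prod_mul_distrib, pow_add, degree,
    Finset.prod_pow_eq_pow_sum]
  simp

theorem IsMajorana.mul_monomial (hγ : IsMajorana γ) (j : Fin (2 * n)) (α : Fin (2 * n) → Fin 2) :
    γ j * monomial γ α = moveSign j α • (monomial γ α * γ j) := by
  have key : ∀ l : List (Fin (2 * n)), γ j * (l.map fun k => γ k ^ (α k : ℕ)).prod
      = (l.map fun k => if k = j then (1 : ℂ) else (-1) ^ (α k : ℕ)).prod •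
        ((l.map fun k => γ k ^ (α k : ℕ)).prod * γ j) := by
    intro l
    induction l with
    | nil => simp
    | cons k l ih =>
      simp only [List.map_cons, List.prod_cons]
      have hk : γ j * γ k ^ (α k : ℕ)
          = (if k = j then (1 : ℂ) else (-1) ^ (α k : ℕ)) • (γ k ^ (α k : ℕ) * γ j) := by
        split_ifs with h
        · subst h; rw [one_smul, ← pow_succ, ← pow_succ']
        · have ha := hγ.anticomm j k
          rw [if_neg (Ne.symm h)] at ha
          have hc : (α k : ℕ) = 0 ∨ (α k : ℕ) = 1 := by omega
          rcases hc with hc | hc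
          · simp [hc]
          · simp [hc, eq_neg_of_add_eq_zero_left ha]
      rw [← mul_assoc, hk, smul_mul_assoc, mul_assoc, ih, mul_smul_comm, smul_smul, mul_assoc]
  have := key (List.finRange (2 * n))
  rw [← List.ofFn_eq_map, ← List.ofFn_eq_map, List.prod_ofFn] at this
  exact this

theorem IsMajorana.star_mul_monomial (hγ : IsMajorana γ) (α : Fin (2 * n) → Fin 2) :
    star (monomial γ α) * monomial γ α = 1 := by
  have : monomial γ α ∈ unitary (Op n) := by
    refine Submonoid.list_prod_mem _ fun x hx => ?_
    obtain ⟨j, rfl⟩ := (List.mem_ofFn' _ _).1 hx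
    refine Submonoid.pow_mem _ ?_ _
    rw [Unitary.mem_iff, hγ.selfAdjoint]
    exact ⟨hγ.sq j, hγ.sq j⟩
  exact (Unitary.mem_iff.1 this).1

theorem IsMajorana.trace_eq_zero (hγ : IsMajorana γ) {α α' : Fin (2 * n) → Fin 2} (h : α ≠ α') :
    LinearMap.trace ℂ (Fock n) (star (monomial γ α) * monomial γ α' : Op n) = 0 := by
  have hj : ∃ j, moveSign j α * moveSign j α' = -1 := by
    simp only [moveSign_eq, ← pow_add]
    by_cases hp : Even (degree α + degree α')
    · obtain ⟨j, hj⟩ := Function.ne_iff.1 h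
      refine ⟨j, Odd.neg_one_pow ?_⟩
      have h1 : (α j : ℕ) ≠ (α' j : ℕ) := fun e => hj (Fin.ext e)
      grind
    · have : ∃ j, α j = α' j := by
        by_contra! hne
        apply hp
        have : degree α + degree α' = 2 * n := by
          rw [degree, degree, ← Finset.sum_add_distrib]
          have : ∀ j, (α j : ℕ) + (α' j : ℕ) = 1 := by
            intro j
            have h1 : (α j : ℕ) ≠ (α' j : ℕ) := fun e => hne j (Fin.ext e)
            omega
          simp [this]
        rw [this]; exact even_two_mul n
      obtain ⟨j, hj⟩ := this
      refine ⟨j, Odd.neg_one_pow ?_⟩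
      rw [hj]
      grind
  obtain ⟨j, hj⟩ := hj
  have hs : ∀ α : Fin (2 * n) → Fin 2, moveSign j α * moveSign j α = 1 := by
    intro α; rw [moveSign_eq, ← mul_pow]; simp
  have hreal : star (moveSign j α) = moveSign j α := by rw [moveSign_eq]; simp
  have h1 : γ j * star (monomial γ α) = moveSign j α • (star (monomial γ α) * γ j) := by
    have := congrArg star (hγ.mul_monomial j α)
    rw [star_mul, star_smul, star_mul, hγ.selfAdjoint, hreal] at this
    rw [this, smul_smul, hs, one_smul]
  set W := star (monomial γ α) * monomial γ α' with hW
  have h2 : γ j * W = -(W * γ j) := by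
    rw [hW, ← mul_assoc, h1, smul_mul_assoc, mul_assoc, hγ.mul_monomial, mul_smul_comm, smul_smul,
      hj, neg_one_smul, mul_assoc]
  have h3 : W = -(γ j * W * γ j) := by
    rw [h2, neg_mul, neg_neg, mul_assoc, hγ.sq, mul_one]
  have h4 : LinearMap.trace ℂ (Fock n) (γ j * W * γ j : Op n)
      = LinearMap.trace ℂ (Fock n) (W : Op n) := by
    have := LinearMap.trace_mul_comm ℂ ((γ j * W : Op n) : Fock n →ₗ[ℂ] Fock n) (γ j : Op n)
    have e : γ j * (γ j * W) = W := by rw [← mul_assoc, hγ.sq, one_mul]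
    calc _ = _ := this
      _ = LinearMap.trace ℂ (Fock n) (γ j * (γ j * W) : Op n) := rfl
      _ = _ := by rw [e]
  have h5 := congrArg (fun X : Op n => LinearMap.trace ℂ (Fock n) (X : Fock n →ₗ[ℂ] Fock n)) h3
  simp only [ContinuousLinearMap.toLinearMap_neg, map_neg] at h5
  rw [h4] at h5
  exact self_eq_neg.1 h5

/-- The coefficient functionals are dual to the ordered products. -/
theorem coeff_monomial (hγ : IsMajorana γ) (α' α : Fin (2 * n) → Fin 2) :
    coeff γ α' (monomial γ α) = if α' = α then 1 else 0 := by
  have : coeff γ α' (monomial γ α) = ((2 : ℂ) ^ n)⁻¹ *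
    LinearMap.trace ℂ (Fock n) (star (monomial γ α') * monomial γ α : Op n) := rfl
  rw [this]
  split_ifs with h
  · subst h
    rw [hγ.star_mul_monomial]
    have h1 : LinearMap.trace ℂ (Fock n) ((1 : Op n) : Fock n →ₗ[ℂ] Fock n)
      = Module.finrank ℂ (Fock n) := LinearMap.trace_one _ _
    rw [h1, Module.finrank_eq_card_basis (stdBasis n).toBasis]
    simp
  · rw [hγ.trace_eq_zero h, mul_zero]

theorem phi_apply (X : Op n) : phi γ X = ∑ α, coeff γ α X • vec α := by
  simp [phi]

theorem phiInv_apply (x : Fock' n) : phiInv γ x = ∑ α, inner ℂ (vec α) x • monomial γ α := by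
  simp [phiInv]

/-- The defining property of the third quantization map. -/
theorem phi_monomial (hγ : IsMajorana γ) (α : Fin (2 * n) → Fin 2) :
    phi γ (monomial γ α) = vec α := by
  simp [phi_apply, coeff_monomial hγ, ite_smul]

theorem phiInv_vec (α : Fin (2 * n) → Fin 2) : phiInv γ (vec α) = monomial γ α := by
  simp [phiInv_apply, vec, OrthonormalBasis.inner_eq_ite, ite_smul]

theorem parity'_vec (α : Fin (2 * n) → Fin 2) :
    parity' n (vec α) = (-1 : ℂ) ^ degree α • vec α := by
  simp [parity', vec, OrthonormalBasis.inner_eq_ite, ite_smul]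

theorem PhiRight_even (hγ : IsMajorana γ) (α : Fin (2 * n) → Fin 2) (h : Even (degree α)) :
    PhiRight γ (monomial γ α) = rep γ (rightMul (monomial γ α)) := by
  have h0 : evenPart γ (monomial γ α) = monomial γ α := by
    simp [evenPart, coeff_monomial hγ, ite_smul, h]
  have h1 : oddPart γ (monomial γ α) = 0 := by
    simp [oddPart, coeff_monomial hγ, ite_smul, h]
  rw [PhiRight, h0, h1]
  simp [rep, rightMul]

theorem PhiRight_odd (hγ : IsMajorana γ) (α : Fin (2 * n) → Fin 2) (h : Odd (degree α)) :
    PhiRight γ (monomial γ α) = rep γ (rightMul (monomial γ α)) * parity' n := by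
  have h0 : oddPart γ (monomial γ α) = monomial γ α := by
    simp [oddPart, coeff_monomial hγ, ite_smul, h]
  have h1 : evenPart γ (monomial γ α) = 0 := by
    simp [evenPart, coeff_monomial hγ, ite_smul, h]
  rw [PhiRight, h0, h1]
  simp [rep, rightMul]

theorem rep_add (X Y : SuperOp n) : rep γ (X + Y) = rep γ X + rep γ Y := by
  simp [rep, ContinuousLinearMap.add_comp, ContinuousLinearMap.comp_add]

theorem rep_smul (c : ℂ) (X : SuperOp n) : rep γ (c • X) = c • rep γ X := by
  simp [rep]

theorem PhiRight_add (W V : Op n) : PhiRight γ (W + V) = PhiRight γ W + PhiRight γ V := by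
  simp only [PhiRight, evenPart, oddPart, map_add, add_smul,
    Finset.sum_add_distrib, rightMul, rep_add, add_mul]
  abel

theorem PhiRight_smul (c : ℂ) (W : Op n) : PhiRight γ (c • W) = c • PhiRight γ W := by
  simp only [PhiRight, evenPart, oddPart, map_smul, smul_eq_mul, mul_smul,
    ← Finset.smul_sum, rightMul, rep_smul, smul_mul_assoc, smul_add]

theorem matUnit_sum (W : Op n) :
    ∑ s, ∑ t, inner ℂ (stdBasis n s) (W (stdBasis n t)) • matUnit s t = W := by
  refine ContinuousLinearMap.coe_injective ((stdBasis n).toBasis.ext fun u => ?_)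
  simp [matUnit, OrthonormalBasis.inner_eq_ite, ite_smul,
    OrthonormalBasis.sum_repr']

theorem rep_leftMul_expand (W : Op n) : rep γ (leftMul W)
    = ∑ s, ∑ t, inner ℂ (stdBasis n s) (W (stdBasis n t)) • rep γ (leftMul (matUnit s t)) := by
  let l : Op n →ₗ[ℂ] Op' n :=
    { toFun := fun W => rep γ (leftMul W)
      map_add' := fun A B => by rw [leftMul, map_add, rep_add]; rfl
      map_smul' := fun c A => by rw [leftMul, map_smul, rep_smul]; rfl }
  have h := congrArg l (matUnit_sum W)
  simp only [map_sum, map_smul] at h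
  exact h.symm

theorem PhiRight_expand (V : Op n) : PhiRight γ V
    = ∑ s, ∑ t, inner ℂ (stdBasis n s) (V (stdBasis n t)) • PhiRight γ (matUnit s t) := by
  let r : Op n →ₗ[ℂ] Op' n :=
    { toFun := PhiRight γ, map_add' := PhiRight_add, map_smul' := PhiRight_smul }
  have h := congrArg r (matUnit_sum V)
  simp only [map_sum, map_smul] at h
  exact h.symm

/-- The defining property of `Φ`. -/
theorem Phi_leftMul_rightMul (W V : Op n) :
    Phi γ (leftMul W * rightMul V) = rep γ (leftMul W) * PhiRight γ V := by
  have key : ∀ s t u v : Fin n → Fin 2,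
      inner ℂ (stdBasis n s) ((leftMul W * rightMul V) (matUnit t u) (stdBasis n v))
      = inner ℂ (stdBasis n s) (W (stdBasis n t)) *
        inner ℂ (stdBasis n u) (V (stdBasis n v)) := by
    intro s t u v
    have : (leftMul W * rightMul V) (matUnit t u) (stdBasis n v)
      = W (inner ℂ (stdBasis n u) (V (stdBasis n v)) • stdBasis n t) := rfl
    rw [this, map_smul, inner_smul_right, mul_comm]
  rw [rep_leftMul_expand W, PhiRight_expand V, Phi]
  simp only [key, Finset.sum_mul]
  refine Finset.sum_congr rfl fun s _ => Finset.sum_congr rfl fun t _ => ?_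
  simp only [Finset.mul_sum, smul_mul_smul_comm]

end

/-- The step of the Jordan-Wigner construction. -/
theorem exists_majorana_matrix (n : ℕ) :
    ∃ g : Fin n × Fin 2 → Matrix (Fin n → Fin 2) (Fin n → Fin 2) ℂ,
      (∀ j, star (g j) = g j) ∧
      ∀ j k, g j * g k + g k * g j = if j = k then 2 else 0 := by
  induction n with
  | zero => exact ⟨fun j => j.1.elim0, fun j => j.1.elim0, fun j => j.1.elim0⟩
  | succ n ih =>
    obtain ⟨g, hg, hgg⟩ := ih
    let p : Fin 2 → Matrix (Fin 2) (Fin 2) ℂ :=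
      ![!![0, 1; 1, 0], !![0, -Complex.I; Complex.I, 0]]
    let z : Matrix (Fin 2) (Fin 2) ℂ := !![1, 0; 0, -1]
    let f : Fin (n + 1) × Fin 2 → Matrix (Fin 2 × (Fin n → Fin 2)) (Fin 2 × (Fin n → Fin 2)) ℂ :=
      fun j => Fin.cases (Matrix.kronecker (p j.2) 1)
        (fun i => Matrix.kronecker z (g (i, j.2))) j.1
    have hp : ∀ b, star (p b) = p b := by
      intro b; fin_cases b <;> ext i j <;> fin_cases i <;> fin_cases j <;> simp [p]
    have hz : star z = z := by
      ext i j; fin_cases i <;> fin_cases j <;> simp [z]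
    have hpp : ∀ b c, p b * p c + p c * p b = if b = c then 2 else 0 := by
      intro b c
      fin_cases b <;> fin_cases c <;> ext i j <;> fin_cases i <;> fin_cases j <;>
        simp [p, Matrix.ofNat_apply] <;> norm_num
    have hpz : ∀ b, p b * z = -(z * p b) := by
      intro b
      fin_cases b <;> ext i j <;> fin_cases i <;> fin_cases j <;> simp [p, z, Matrix.mul_apply]
    have hzz : z * z = 1 := by
      ext i j; fin_cases i <;> fin_cases j <;> simp [z, Matrix.mul_apply]
    let e := (Fin.consEquiv (fun _ : Fin (n + 1) => Fin 2))
    refine ⟨fun j => Matrix.reindexAlgEquiv ℂ ℂ e (f j), ?_, ?_⟩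
    · intro j
      have : star (f j) = f j := by
        obtain ⟨i, b⟩ := j
        induction i using Fin.cases with
        | zero =>
          change (Matrix.kronecker (p b) 1).conjTranspose = Matrix.kronecker (p b) 1
          rw [Matrix.kronecker, Matrix.conjTranspose_kronecker]
          simp [← Matrix.star_eq_conjTranspose, hp]
        | succ i =>
          change (Matrix.kronecker z (g (i, b))).conjTranspose = Matrix.kronecker z (g (i, b))
          rw [Matrix.kronecker, Matrix.conjTranspose_kronecker]
          simp [← Matrix.star_eq_conjTranspose, hz, hg]
      have h := congrArg (Matrix.reindexAlgEquiv ℂ ℂ e) this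
      exact h
    · intro j k
      have : f j * f k + f k * f j = if j = k then 2 else 0 := by
        obtain ⟨i, b⟩ := j
        obtain ⟨i', b'⟩ := k
        induction i using Fin.cases with
        | zero =>
          induction i' using Fin.cases with
          | zero =>
            change Matrix.kronecker (p b) 1 * Matrix.kronecker (p b') 1
              + Matrix.kronecker (p b') 1 * Matrix.kronecker (p b) 1 = _
            simp only [Matrix.kronecker, ← Matrix.mul_kronecker_mul, ← Matrix.add_kronecker, hpp,
              mul_one, Prod.mk.injEq, true_and]
            split_ifs
            · rw [show (2 : Matrix (Fin 2) (Fin 2) ℂ) = 1 + 1 by norm_num, Matrix.add_kronecker,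
                Matrix.one_kronecker_one]
              norm_num
            · exact Matrix.zero_kronecker _
          | succ i' =>
            change Matrix.kronecker (p b) 1 * Matrix.kronecker z (g (i', b'))
              + Matrix.kronecker z (g (i', b')) * Matrix.kronecker (p b) 1 = _
            simp only [Matrix.kronecker, ← Matrix.mul_kronecker_mul, mul_one, one_mul,
              ← Matrix.add_kronecker, hpz, neg_add_cancel]
            rw [if_neg (by simp [Fin.ext_iff])]
            exact Matrix.zero_kronecker _
        | succ i =>
          induction i' using Fin.cases with
          | zero =>
            change Matrix.kronecker z (g (i, b)) * Matrix.kronecker (p b') 1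
              + Matrix.kronecker (p b') 1 * Matrix.kronecker z (g (i, b)) = _
            simp only [Matrix.kronecker, ← Matrix.mul_kronecker_mul, mul_one, one_mul,
              ← Matrix.add_kronecker, hpz, add_neg_cancel]
            rw [if_neg (by simp [Fin.ext_iff])]
            exact Matrix.zero_kronecker _
          | succ i' =>
            change Matrix.kronecker z (g (i, b)) * Matrix.kronecker z (g (i', b'))
              + Matrix.kronecker z (g (i', b')) * Matrix.kronecker z (g (i, b)) = _
            simp only [Matrix.kronecker, ← Matrix.mul_kronecker_mul, hzz,
              ← Matrix.kronecker_add, hgg, Prod.mk.injEq, Fin.succ_inj]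
            split_ifs
            · rw [show (2 : Matrix (Fin n → Fin 2) (Fin n → Fin 2) ℂ) = 1 + 1 by norm_num,
                Matrix.kronecker_add, Matrix.one_kronecker_one]
              norm_num
            · exact Matrix.kronecker_zero _
      rw [← map_mul, ← map_mul, ← map_add, this]
      by_cases h : j = k
      · rw [if_pos h, if_pos h, map_ofNat]
      · rw [if_neg h, if_neg h, map_zero]

/-- Majorana operators exist for every number of modes. -/
theorem exists_isMajorana (n : ℕ) : ∃ γ : Fin (2 * n) → Op n, IsMajorana γ := by
  obtain ⟨g, hg, hgg⟩ := exists_majorana_matrix n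
  let c : Fin (2 * n) ≃ Fin n × Fin 2 := (finCongr (mul_comm 2 n)).trans finProdFinEquiv.symm
  let E : Matrix (Fin n → Fin 2) (Fin n → Fin 2) ℂ ≃⋆ₐ[ℂ] Op n :=
    Matrix.toEuclideanCLM (𝕜 := ℂ)
  refine ⟨fun j => E (g (c j)), fun j => ?_, fun j k => ?_⟩
  · rw [← map_star, hg]
  · rw [← map_mul, ← map_mul, ← map_add, hgg]
    by_cases h : j = k
    · rw [if_pos h, if_pos (congrArg c h), map_ofNat]
    · rw [if_neg h, if_neg fun e => h (c.injective e), map_zero]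

end FreeFermion

end

/-! The parent Hamiltonian is a sum of commuting number operators of `2n` fermion modes, and
everything is read off from that form. Let `A` be the antisymmetric part of `h`. The commutator with
`K = H₀` acts linearly on the span of the Majorana operators, through `4 A`, and self-adjointness of
`K` makes `A` Hermitian. A unitary `U` diagonalizing `A` gives normal modes `b_k = ∑_j U_{jk} γ_j`
with `[K, b_k] = 4 ε_k b_k`. Time evolution and Gibbs conjugation multiply each `b_k` by a scalar,
and the sum over `j` removes all cross terms because `U` is unitary. The coherent part then contains
only the factors `∫ b₁`, which vanish since `b₁` is odd (`sum_coherentTilde`). In the dissipative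
part only Gaussian integrals remain (`parentD_eq`), leaving with `θ = rate β` `∑_k θ(ε_k) (L_{b_k}
R_{b_k†} - ½ exp(2βε_k) (L_{b_k b_k†} + R_{b_k b_k†}))`. Under `Φ`, the parity twist makes left and
right multiplications by odd operators anticommute. The combinations `exp(βε_k) L_{b_k†} -
exp(-βε_k) R_{b_k†}`, suitably normalized, are therefore annihilators `a_k` (`isCAR`). Since
conjugation exchanges the energies `ε` and `-ε`, the sum above equals `-∑_k λ_k a_k† a_k` with `λ_k
= 2 θ(ε_k) cosh(2βε_k) > 0` (`parentHamiltonian_eq`). For such an operator the kernel is the joint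
kernel of the `a_k`, which is a line because `2n` modes act on dimension `2^{2n}`. The nonzero
eigenvalues lie below some `-λ_k`, and every `-λ_k` is attained. Uniformity in `n` comes from
locality: traces against `γ_j γ_k` bound the entries of `A`, lattice-point counting bounds its row
sums, and Gershgorin's theorem bounds `|ε_k|` (`abs_energy_le`). On a bounded range of energies
`λ_k` is bounded below. -/

noncomputable section

namespace FreeFermion

/-! ### Quadratic Hamiltonians of canonical anti-commutation relations -/

section CAR

set_option linter.unusedSectionVars false

variable {E ι : Type*} [NormedAddCommGroup E] [InnerProductSpace ℂ E] [FiniteDimensional ℂ E]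
  [CompleteSpace E] [Fintype ι] [DecidableEq ι]

/-- The canonical anti-commutation relations of annihilation operators. -/
structure IsCAR (c : ι → E →L[ℂ] E) : Prop where
  anticomm : ∀ k l, c k * c l + c l * c k = 0
  anticomm_star : ∀ k l, c k * star (c l) + star (c l) * c k = if k = l then 1 else 0

/-- The number-conserving Hamiltonian `-∑ λ_k c_k† c_k`. -/
def carHamiltonian (c : ι → E →L[ℂ] E) (lam : ι → ℝ) : E →L[ℂ] E :=
  -∑ k, (lam k : ℂ) • (star (c k) * c k)

variable {c : ι → E →L[ℂ] E}

theorem IsCAR.apply_apply (hc : IsCAR c) (k l : ι) (x : E) : c k (c l x) = -c l (c k x) :=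
  eq_neg_of_add_eq_zero_left (DFunLike.congr_fun (hc.anticomm k l) x)

theorem IsCAR.apply_star_self (hc : IsCAR c) (k : ι) (x : E) :
    c k (star (c k) x) = x - star (c k) (c k x) := by
  have := DFunLike.congr_fun (hc.anticomm_star k k) x
  rw [if_pos rfl] at this
  exact eq_sub_of_add_eq this

theorem IsCAR.apply_star_ne (hc : IsCAR c) {k l : ι} (h : k ≠ l) (x : E) :
    c k (star (c l) x) = -star (c l) (c k x) := by
  have := DFunLike.congr_fun (hc.anticomm_star k l) x
  rw [if_neg h] at this
  exact eq_neg_of_add_eq_zero_left this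

theorem IsCAR.apply_self (hc : IsCAR c) (k : ι) (x : E) : c k (c k x) = 0 := by
  have h := hc.apply_apply k k x
  have h2 : (2 : ℂ) • c k (c k x) = 0 := by rw [two_smul]; nth_rw 1 [h]; exact neg_add_cancel _
  exact (smul_eq_zero.1 h2).resolve_left two_ne_zero

/-- The subspace on which all annihilators `c_k`, `k ∈ S`, vanish. -/
def vacuumSpace (c : ι → E →L[ℂ] E) (S : Finset ι) : Submodule ℂ E where
  carrier := {x | ∀ k ∈ S, c k x = 0}
  add_mem' hx hy k hk := by rw [map_add, hx k hk, hy k hk, add_zero]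
  zero_mem' k _ := map_zero _
  smul_mem' a x hx k hk := by rw [map_smul, hx k hk, smul_zero]

theorem mem_vacuumSpace {S : Finset ι} {x : E} :
    x ∈ vacuumSpace c S ↔ ∀ k ∈ S, c k x = 0 := Iff.rfl

/-- Each further annihilator halves the dimension. Restricted to the vacuum space of `S`, the
operator `c k` has the vacuum space of `insert k S` both as its kernel and as its range, so
rank-nullity applies. -/
theorem IsCAR.finrank_vacuumSpace (hc : IsCAR c) (S : Finset ι) :
    Module.finrank ℂ (vacuumSpace c S) * 2 ^ S.card = Module.finrank ℂ E := by
  induction S using Finset.induction_on with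
  | empty =>
    have : vacuumSpace c ∅ = ⊤ := eq_top_iff.2 fun x _ k hk => absurd hk (Finset.notMem_empty k)
    rw [this, finrank_top, Finset.card_empty, pow_zero, mul_one]
  | insert k S hk ih =>
    rw [← ih, Finset.card_insert_of_notMem hk, pow_succ', ← mul_assoc]
    congr 1
    let f : vacuumSpace c S →ₗ[ℂ] E := (c k : E →ₗ[ℂ] E).domRestrict (vacuumSpace c S)
    have hrange : LinearMap.range f = vacuumSpace c (insert k S) := by
      ext x
      constructor
      · rintro ⟨y, rfl⟩ l hl
        rcases Finset.mem_insert.1 hl with rfl | hl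
        · exact hc.apply_self _ _
        · have : c l (c k y) = 0 := by rw [hc.apply_apply, y.2 l hl, map_zero, neg_zero]
          exact this
      -- A preimage of `x` is `c_k† x`, since `c_k c_k† x = x` as soon as `c_k x = 0`.
      · intro hx
        refine ⟨⟨star (c k) x, fun l hl => ?_⟩, ?_⟩
        · have hne : l ≠ k := fun h => hk (h ▸ hl)
          rw [hc.apply_star_ne hne, hx l (Finset.mem_insert_of_mem hl), map_zero, neg_zero]
        · change c k (star (c k) x) = x
          rw [hc.apply_star_self, hx k (Finset.mem_insert_self _ _), map_zero, sub_zero]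
    have hker : Module.finrank ℂ (LinearMap.ker f)
        = Module.finrank ℂ (vacuumSpace c (insert k S)) := by
      have h : (LinearMap.ker f).map (vacuumSpace c S).subtype = vacuumSpace c (insert k S) := by
        ext x
        constructor
        · rintro ⟨y, hy, rfl⟩ l hl
          rcases Finset.mem_insert.1 hl with rfl | hl
          · exact hy
          · exact y.2 l hl
        · intro hx
          exact ⟨⟨x, fun l hl => hx l (Finset.mem_insert_of_mem hl)⟩,
            hx k (Finset.mem_insert_self _ _), rfl⟩
      rw [← h, Submodule.finrank_map_subtype_eq]
    have := f.finrank_range_add_finrank_ker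
    rw [hrange, hker] at this
    omega

theorem IsCAR.finrank_vacuumSpace_univ (hc : IsCAR c)
    (hE : Module.finrank ℂ E = 2 ^ Fintype.card ι) :
    Module.finrank ℂ (vacuumSpace c Finset.univ) = 1 := by
  have := hc.finrank_vacuumSpace Finset.univ
  rw [hE, Finset.card_univ] at this
  exact Nat.eq_of_mul_eq_mul_right (by positivity) (this.trans (one_mul _).symm)

theorem carHamiltonian_isSelfAdjoint (lam : ι → ℝ) : IsSelfAdjoint (carHamiltonian c lam) := by
  rw [IsSelfAdjoint, carHamiltonian, star_neg, star_sum]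
  congr 1
  refine Finset.sum_congr rfl fun k _ => ?_
  rw [star_smul, star_mul, star_star]
  simp

theorem carHamiltonian_apply (lam : ι → ℝ) (x : E) :
    carHamiltonian c lam x = -∑ k, (lam k : ℂ) • star (c k) (c k x) := by
  simp [carHamiltonian]

/-- This quadratic form yields both negative semidefiniteness and the kernel when all `lam k` are
positive. -/
theorem inner_carHamiltonian (lam : ι → ℝ) (x : E) :
    inner ℂ x (carHamiltonian c lam x) = ((-∑ k, lam k * ‖c k x‖ ^ 2 : ℝ) : ℂ) := by
  rw [carHamiltonian_apply, inner_neg_right, inner_sum]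
  push_cast
  congr 1
  refine Finset.sum_congr rfl fun k _ => ?_
  rw [inner_smul_right, ContinuousLinearMap.star_eq_adjoint,
    ContinuousLinearMap.adjoint_inner_right, inner_self_eq_norm_sq_to_K]
  rfl

theorem carHamiltonian_eq_zero_iff {lam : ι → ℝ} (hlam : ∀ k, 0 < lam k) (x : E) :
    carHamiltonian c lam x = 0 ↔ ∀ k, c k x = 0 := by
  constructor
  · intro h k
    have h1 := inner_carHamiltonian (c := c) lam x
    rw [h, inner_zero_right] at h1
    have h2 : ∑ k, lam k * ‖c k x‖ ^ 2 = 0 := by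
      have : (0 : ℝ) = -∑ k, lam k * ‖c k x‖ ^ 2 := by exact_mod_cast h1
      linarith
    have h3 := (Finset.sum_eq_zero_iff_of_nonneg fun k _ =>
      mul_nonneg (hlam k).le (sq_nonneg _)).1 h2 k (Finset.mem_univ k)
    simpa [(hlam k).ne'] using h3
  · intro h
    simp [carHamiltonian_apply, h]

/-- Eigenvalues of `-∑ λ_k c_k† c_k` are real and nonpositive. -/
theorem carHamiltonian_eigenvalue_nonpos {lam : ι → ℝ} (hlam : ∀ k, 0 < lam k) {x : E} {μ : ℂ}
    (hx : carHamiltonian c lam x = μ • x) (h0 : x ≠ 0) : μ.im = 0 ∧ μ.re ≤ 0 := by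
  have h1 := inner_carHamiltonian (c := c) lam x
  rw [hx, inner_smul_right, inner_self_eq_norm_sq_to_K] at h1
  have hpos : 0 < ‖x‖ ^ 2 := by positivity
  have h2 : 0 ≤ ∑ k, lam k * ‖c k x‖ ^ 2 :=
    Finset.sum_nonneg fun k _ => mul_nonneg (hlam k).le (sq_nonneg _)
  have h3 : μ * ((‖x‖ ^ 2 : ℝ) : ℂ) = ((-∑ k, lam k * ‖c k x‖ ^ 2 : ℝ) : ℂ) := by
    rw [← h1]; push_cast; rfl
  have him := congrArg Complex.im h3
  have hre := congrArg Complex.re h3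
  rw [Complex.im_mul_ofReal, Complex.ofReal_im] at him
  rw [Complex.re_mul_ofReal, Complex.ofReal_re] at hre
  refine ⟨(mul_eq_zero.1 him).resolve_right hpos.ne', ?_⟩
  by_contra! h
  have := mul_pos h hpos
  linarith

/-- Removing a particle from mode `l` raises the eigenvalue by `lam l`. This ladder relation
replaces a full Fock basis in the spectral bound. -/
theorem IsCAR.carHamiltonian_lower (hc : IsCAR c) (lam : ι → ℝ) (l : ι) (x : E) :
    carHamiltonian c lam (c l x) = c l (carHamiltonian c lam x) + (lam l : ℂ) • c l x := by
  have hterm : ∀ k, star (c k) (c k (c l x))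
      = c l (star (c k) (c k x)) - (if k = l then c l x else 0) := by
    intro k
    split_ifs with h
    · subst h
      rw [hc.apply_self, hc.apply_star_self, hc.apply_self]; simp
    · rw [hc.apply_apply k l, hc.apply_star_ne (Ne.symm h)]; simp
  rw [carHamiltonian_apply, carHamiltonian_apply, map_neg, map_sum]
  simp only [hterm, smul_sub, Finset.sum_sub_distrib, map_smul]
  simp only [smul_ite, smul_zero, Finset.sum_ite_eq', Finset.mem_univ, if_true]
  abel

/-- Every nonzero eigenvalue lies below some `-λ_k`. -/
theorem IsCAR.exists_eigenvalue_le (hc : IsCAR c) {lam : ι → ℝ} (hlam : ∀ k, 0 < lam k) {μ : ℂ}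
    (hμ : Module.End.HasEigenvalue (carHamiltonian c lam).toLinearMap μ) (h0 : μ ≠ 0) :
    μ.im = 0 ∧ ∃ k, μ.re ≤ -lam k := by
  obtain ⟨x, hx⟩ := hμ.exists_hasEigenvector
  have hx1 : carHamiltonian c lam x = μ • x := hx.apply_eq_smul
  refine ⟨(carHamiltonian_eigenvalue_nonpos hlam hx1 hx.2).1, ?_⟩
  -- An eigenvector with nonzero eigenvalue is not a vacuum vector. Applying some `c k` gives an
  -- eigenvector for `μ + lam k`, which must again be nonpositive.
  have : ∃ k, c k x ≠ 0 := by
    by_contra! h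
    rw [(carHamiltonian_eq_zero_iff hlam x).2 h] at hx1
    exact (smul_ne_zero h0 hx.2) hx1.symm
  obtain ⟨k, hk⟩ := this
  have h1 : carHamiltonian c lam (c k x) = (μ + lam k) • c k x := by
    rw [hc.carHamiltonian_lower, hx1, map_smul, add_smul]
  have h2 := (carHamiltonian_eigenvalue_nonpos hlam h1 hk).2
  rw [Complex.add_re, Complex.ofReal_re] at h2
  exact ⟨k, by linarith⟩

theorem eigenspace_carHamiltonian {lam : ι → ℝ} (hlam : ∀ k, 0 < lam k) :
    Module.End.eigenspace (carHamiltonian c lam).toLinearMap 0 = vacuumSpace c Finset.univ := by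
  ext x
  rw [Module.End.mem_eigenspace_iff, zero_smul, mem_vacuumSpace]
  exact (carHamiltonian_eq_zero_iff hlam x).trans (by simp)

/-- Each `-λ_k` is an eigenvalue. -/
theorem IsCAR.hasEigenvalue (hc : IsCAR c) (hE : Module.finrank ℂ E = 2 ^ Fintype.card ι)
    (lam : ι → ℝ) (k : ι) :
    Module.End.HasEigenvalue (carHamiltonian c lam).toLinearMap ((-lam k : ℝ) : ℂ) := by
  have h1 := hc.finrank_vacuumSpace_univ hE
  obtain ⟨⟨v, hv⟩, hv0⟩ := Module.finrank_pos_iff_exists_ne_zero.1 (h1 ▸ one_pos)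
  have hv' : ∀ l, c l v = 0 := fun l => hv l (Finset.mem_univ l)
  -- The one-particle state `c_k† v` over the vacuum `v` is the eigenvector; this identity also
  -- shows that it is nonzero.
  have hck : c k (star (c k) v) = v := by rw [hc.apply_star_self, hv', map_zero, sub_zero]
  refine Module.End.hasEigenvalue_of_hasEigenvector (x := star (c k) v)
    ⟨Module.End.mem_eigenspace_iff.2 ?_, fun h => ?_⟩
  · change carHamiltonian c lam (star (c k) v) = _
    rw [carHamiltonian_apply, Finset.sum_eq_single k]
    · rw [hck]; simp
    · intro l _ hl
      rw [hc.apply_star_ne hl, hv']; simp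
    · simp
  · rw [h, map_zero] at hck
    exact hv0 (Subtype.ext hck.symm)

end CAR

/-! ### The third quantization map is a unitary star representation -/

section ThirdQuantization

variable {n : ℕ} {γ : Fin (2 * n) → Op n}

theorem IsMajorana.monomial_mem_unitary (hγ : IsMajorana γ) (α : Fin (2 * n) → Fin 2) :
    monomial γ α ∈ unitary (Op n) := by
  refine Submonoid.list_prod_mem _ fun x hx => ?_
  obtain ⟨j, rfl⟩ := (List.mem_ofFn' _ _).1 hx
  refine Submonoid.pow_mem _ ?_ _
  rw [Unitary.mem_iff, hγ.selfAdjoint]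
  exact ⟨hγ.sq j, hγ.sq j⟩

/-- The product of all Majorana operators, which implements the parity. -/
def chirality (γ : Fin (2 * n) → Op n) : Op n := monomial γ fun _ => 1

theorem IsMajorana.star_chirality_mul (hγ : IsMajorana γ) :
    star (chirality γ) * chirality γ = 1 :=
  (Unitary.mem_iff.1 (hγ.monomial_mem_unitary _)).1

theorem IsMajorana.chirality_mul_star (hγ : IsMajorana γ) :
    chirality γ * star (chirality γ) = 1 :=
  (Unitary.mem_iff.1 (hγ.monomial_mem_unitary _)).2

theorem IsMajorana.chirality_mul (hγ : IsMajorana γ) (j : Fin (2 * n)) :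
    chirality γ * γ j = -(γ j * chirality γ) := by
  have h := hγ.mul_monomial j fun _ => 1
  rw [moveSign_eq] at h
  have : (-1 : ℂ) ^ (degree (fun _ : Fin (2 * n) => (1 : Fin 2)) + ((1 : Fin 2) : ℕ)) = -1 := by
    simp [degree, pow_succ]
  rw [this, neg_one_smul] at h
  rw [chirality, h, neg_neg]

theorem IsMajorana.chirality_mul_monomial (hγ : IsMajorana γ) (α : Fin (2 * n) → Fin 2) :
    chirality γ * monomial γ α = (-1 : ℂ) ^ degree α • (monomial γ α * chirality γ) := by
  have key : ∀ l : List (Fin (2 * n)), chirality γ * (l.map fun k => γ k ^ (α k : ℕ)).prod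
      = (l.map fun k => (-1 : ℂ) ^ (α k : ℕ)).prod •
        ((l.map fun k => γ k ^ (α k : ℕ)).prod * chirality γ) := by
    intro l
    induction l with
    | nil => simp
    | cons k l ih =>
      simp only [List.map_cons, List.prod_cons]
      have hk : chirality γ * γ k ^ (α k : ℕ)
          = (-1 : ℂ) ^ (α k : ℕ) • (γ k ^ (α k : ℕ) * chirality γ) := by
        have hc : (α k : ℕ) = 0 ∨ (α k : ℕ) = 1 := by omega
        rcases hc with hc | hc
        · simp [hc]
        · simp [hc, hγ.chirality_mul]
      rw [← mul_assoc, hk, smul_mul_assoc, mul_assoc, ih, mul_smul_comm, smul_smul, mul_assoc]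
  have := key (List.finRange (2 * n))
  rw [← List.ofFn_eq_map, ← List.ofFn_eq_map, List.prod_ofFn, Finset.prod_pow_eq_pow_sum] at this
  exact this

theorem phi_phiInv (hγ : IsMajorana γ) (x : Fock' n) : phi γ (phiInv γ x) = x := by
  rw [phiInv_apply, map_sum]
  simp only [map_smul, phi_monomial hγ]
  exact (stdBasis (2 * n)).sum_repr' x

theorem finrank_fock (m : ℕ) : Module.finrank ℂ (Fock m) = 2 ^ m := by
  rw [Module.finrank_eq_card_basis (stdBasis m).toBasis]
  simp

theorem finrank_op (m : ℕ) : Module.finrank ℂ (Op m) = 2 ^ (2 * m) := by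
  rw [← (LinearMap.toContinuousLinearMap : (Fock m →ₗ[ℂ] Fock m) ≃ₗ[ℂ] Op m).finrank_eq,
    Module.finrank_linearMap, finrank_fock]
  ring

/-- A one-sided inverse suffices, both spaces having dimension `2^{2n}`. In particular the monomials
span all operators. -/
theorem phiInv_phi (hγ : IsMajorana γ) (X : Op n) : phiInv γ (phi γ X) = X := by
  have hinj : Function.Injective (phi γ : Op n →ₗ[ℂ] Fock' n) := by
    rw [LinearMap.injective_iff_surjective_of_finrank_eq_finrank
      ((finrank_op n).trans (finrank_fock (2 * n)).symm)]
    exact fun x => ⟨phiInv γ x, phi_phiInv hγ x⟩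
  exact hinj (phi_phiInv hγ _)

theorem sum_coeff_monomial (hγ : IsMajorana γ) (X : Op n) :
    ∑ α, coeff γ α X • monomial γ α = X := by
  conv_rhs => rw [← phiInv_phi hγ X, phi_apply, map_sum]
  simp only [map_smul, phiInv_vec]

theorem rep_mul (hγ : IsMajorana γ) (X Y : SuperOp n) : rep γ (X * Y) = rep γ X * rep γ Y := by
  ext1 x
  change phi γ (X (Y (phiInv γ x))) = phi γ (X (phiInv γ (phi γ (Y (phiInv γ x)))))
  rw [phiInv_phi hγ]

theorem rep_phi (hγ : IsMajorana γ) (X : SuperOp n) (Y : Op n) :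
    rep γ X (phi γ Y) = phi γ (X Y) := by
  change phi γ (X (phiInv γ (phi γ Y))) = _
  rw [phiInv_phi hγ]

theorem rep_one (hγ : IsMajorana γ) : rep γ 1 = 1 := by
  ext1 x
  exact phi_phiInv hγ x

theorem leftMul_mul (A B : Op n) : leftMul (A * B) = leftMul A * leftMul B := by
  ext1 X; exact mul_assoc _ _ _

theorem rightMul_mul (A B : Op n) : rightMul (A * B) = rightMul B * rightMul A := by
  ext1 X; exact (mul_assoc _ _ _).symm

theorem leftMul_comm_rightMul (A B : Op n) :
    leftMul A * rightMul B = rightMul B * leftMul A := by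
  ext1 X; exact (mul_assoc _ _ _).symm

theorem leftMul_one : leftMul (1 : Op n) = 1 := by ext1 X; exact one_mul X

theorem rightMul_one : rightMul (1 : Op n) = 1 := by ext1 X; exact mul_one X

/-- Conjugation by the product of all Majorana operators multiplies a monomial of degree `d` by
`(-1)^d`. Parity on `H'` thus becomes a super-operator, and its commutation rules reduce to those of
the chirality. -/
theorem parity'_eq_rep (hγ : IsMajorana γ) :
    parity' n = rep γ (leftMul (chirality γ) * rightMul (star (chirality γ))) := by
  refine ContinuousLinearMap.coe_injective ((stdBasis (2 * n)).toBasis.ext fun α => ?_)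
  rw [OrthonormalBasis.coe_toBasis]
  change parity' n (vec α) = phi γ (chirality γ * (phiInv γ (vec α) * star (chirality γ)))
  rw [parity'_vec, phiInv_vec, ← mul_assoc, hγ.chirality_mul_monomial, smul_mul_assoc, mul_assoc,
    hγ.chirality_mul_star, mul_one, map_smul, phi_monomial hγ]

theorem star_parity' : star (parity' n) = parity' n := by
  rw [parity', star_sum]
  refine Finset.sum_congr rfl fun α _ => ?_
  rw [star_smul, ContinuousLinearMap.star_eq_adjoint, InnerProductSpace.adjoint_rankOne]
  simp

theorem parity'_mul_self : parity' n * parity' n = 1 := by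
  refine ContinuousLinearMap.coe_injective ((stdBasis (2 * n)).toBasis.ext fun α => ?_)
  rw [OrthonormalBasis.coe_toBasis]
  change parity' n (parity' n (vec α)) = vec α
  rw [parity'_vec, map_smul, parity'_vec, smul_smul, ← mul_pow]
  simp

/-- Conjugation by parity changes the sign of multiplication by odd operators. -/
theorem parity'_mul_leftMul (hγ : IsMajorana γ) {W : Op n}
    (hW : chirality γ * W = -(W * chirality γ)) :
    parity' n * rep γ (leftMul W) = -(rep γ (leftMul W) * parity' n) := by
  rw [parity'_eq_rep hγ, ← rep_mul hγ, ← rep_mul hγ, ← neg_one_smul ℂ, ← rep_smul]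
  congr 1
  ext1 X
  change chirality γ * (W * X * star (chirality γ))
    = (-1 : ℂ) • (W * (chirality γ * (X * star (chirality γ))))
  rw [mul_assoc, ← mul_assoc, hW]
  simp [mul_assoc]

theorem parity'_mul_rightMul (hγ : IsMajorana γ) {W : Op n}
    (hW : chirality γ * W = -(W * chirality γ)) :
    parity' n * rep γ (rightMul W) = -(rep γ (rightMul W) * parity' n) := by
  rw [parity'_eq_rep hγ, ← rep_mul hγ, ← rep_mul hγ, ← neg_one_smul ℂ, ← rep_smul]
  congr 1
  have h2 : W * star (chirality γ) = -(star (chirality γ) * W) := by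
    calc W * star (chirality γ)
        = star (chirality γ) * (chirality γ * W) * star (chirality γ) := by
          rw [← mul_assoc, hγ.star_chirality_mul, one_mul]
      _ = _ := by
          rw [hW, mul_neg, neg_mul, mul_assoc, mul_assoc, hγ.chirality_mul_star, mul_one]
  ext1 X
  change chirality γ * (X * W * star (chirality γ))
    = (-1 : ℂ) • (chirality γ * (X * star (chirality γ)) * W)
  rw [mul_assoc, h2]
  simp [mul_assoc]

theorem evenPart_add_oddPart (hγ : IsMajorana γ) (W : Op n) :
    evenPart γ W + oddPart γ W = W := by
  conv_rhs => rw [← sum_coeff_monomial hγ W]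
  rw [evenPart, oddPart, ← Finset.sum_filter_add_sum_filter_not Finset.univ
    (fun α => Even (degree α))]
  simp only [Nat.not_even_iff_odd]

theorem chirality_mul_evenPart (hγ : IsMajorana γ) (W : Op n) :
    chirality γ * evenPart γ W = evenPart γ W * chirality γ := by
  rw [evenPart, Finset.mul_sum, Finset.sum_mul]
  refine Finset.sum_congr rfl fun α hα => ?_
  rw [mul_smul_comm, hγ.chirality_mul_monomial, (Finset.mem_filter.1 hα).2.neg_one_pow, one_smul,
    smul_mul_assoc]

theorem chirality_mul_oddPart (hγ : IsMajorana γ) (W : Op n) :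
    chirality γ * oddPart γ W = -(oddPart γ W * chirality γ) := by
  rw [oddPart, Finset.mul_sum, Finset.sum_mul, ← Finset.sum_neg_distrib]
  refine Finset.sum_congr rfl fun α hα => ?_
  rw [mul_smul_comm, hγ.chirality_mul_monomial, (Finset.mem_filter.1 hα).2.neg_one_pow,
    neg_one_smul, smul_mul_assoc, smul_neg]

theorem eq_zero_of_mul_chirality (hγ : IsMajorana γ) {W : Op n}
    (h : W * chirality γ = -(W * chirality γ)) : W = 0 := by
  have h2 : (2 : ℂ) • (W * chirality γ) = 0 := by
    rw [two_smul]; nth_rw 1 [h]; exact neg_add_cancel _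
  have h3 := (smul_eq_zero.1 h2).resolve_left two_ne_zero
  have := congrArg (· * star (chirality γ)) h3
  simpa [mul_assoc, hγ.chirality_mul_star] using this

/-- The odd part of `W` both commutes and anticommutes with the invertible chirality, hence
vanishes. Evenness and oddness can thus be tested by commutation, without expanding in monomials. -/
theorem PhiRight_of_commute (hγ : IsMajorana γ) {W : Op n}
    (hW : chirality γ * W = W * chirality γ) : PhiRight γ W = rep γ (rightMul W) := by
  have hs := evenPart_add_oddPart hγ W
  have h0 : oddPart γ W = 0 := by
    apply eq_zero_of_mul_chirality hγ
    rw [← chirality_mul_oddPart hγ, eq_sub_of_add_eq' hs, mul_sub, sub_mul, hW,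
      chirality_mul_evenPart hγ]
  rw [h0, add_zero] at hs
  rw [PhiRight, h0, hs]
  simp [rep, rightMul]

theorem PhiRight_of_anticommute (hγ : IsMajorana γ) {W : Op n}
    (hW : chirality γ * W = -(W * chirality γ)) :
    PhiRight γ W = rep γ (rightMul W) * parity' n := by
  have hs := evenPart_add_oddPart hγ W
  have h0 : evenPart γ W = 0 := by
    apply eq_zero_of_mul_chirality hγ
    have e : evenPart γ W = W - oddPart γ W := eq_sub_of_add_eq hs
    have h1 := chirality_mul_evenPart hγ W
    rw [e, mul_sub, hW, chirality_mul_oddPart hγ, sub_mul] at h1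
    rw [e, sub_mul]
    nth_rw 1 [← h1]
    abel
  rw [h0, zero_add] at hs
  rw [PhiRight, h0, hs]
  simp [rep, rightMul]

/-- `φ` is unitary for the normalized Hilbert-Schmidt inner product. -/
theorem inner_phi (hγ : IsMajorana γ) (X Y : Op n) :
    inner ℂ (phi γ X) (phi γ Y)
      = ((2 : ℂ) ^ n)⁻¹ * LinearMap.trace ℂ (Fock n) (star X * Y : Op n) := by
  have h1 : inner ℂ (phi γ X) (phi γ Y) = ∑ α, star (coeff γ α X) * coeff γ α Y := by
    rw [phi_apply, phi_apply]
    simp only [sum_inner, inner_sum, inner_smul_left, inner_smul_right, vec,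
      OrthonormalBasis.inner_eq_ite]
    simp [mul_comm]
  let T : Op n →ₗ[ℂ] ℂ := ((2 : ℂ) ^ n)⁻¹ •
    (LinearMap.trace ℂ (Fock n) ∘ₗ ContinuousLinearMap.coeLM ℂ)
  have h2 : ∀ Z : Op n, T Z = ((2 : ℂ) ^ n)⁻¹ * LinearMap.trace ℂ (Fock n) (Z : Op n) :=
    fun _ => rfl
  rw [h1, ← h2]
  conv_rhs => rw [← sum_coeff_monomial hγ X, star_sum, Finset.sum_mul, map_sum]
  refine Finset.sum_congr rfl fun α _ => ?_
  rw [star_smul, smul_mul_assoc, map_smul]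
  rfl

/-- As `φ` is unitary for the normalized Hilbert-Schmidt product, adjoints on `H'` can be checked on
traces. -/
theorem star_rep_eq (hγ : IsMajorana γ) {X Y : SuperOp n}
    (h : ∀ V W : Op n, LinearMap.trace ℂ (Fock n) (star (X V) * W : Op n)
      = LinearMap.trace ℂ (Fock n) (star V * Y W : Op n)) :
    star (rep γ X) = rep γ Y := by
  rw [ContinuousLinearMap.star_eq_adjoint, eq_comm, ContinuousLinearMap.eq_adjoint_iff]
  intro x y
  rw [← phi_phiInv hγ x, ← phi_phiInv hγ y, rep_phi hγ, rep_phi hγ, inner_phi hγ, inner_phi hγ]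
  congr 1
  -- The criterion for the adjoint is the complex conjugate of the hypothesis, hence the swapped
  -- arguments.
  have h' := h (phiInv γ y) (phiInv γ x)
  have hc : ∀ Z : Op n, LinearMap.trace ℂ (Fock n) (star Z : Op n)
      = star (LinearMap.trace ℂ (Fock n) (Z : Op n)) := by
    intro Z
    rw [LinearMap.trace_eq_sum_inner _ (stdBasis n), LinearMap.trace_eq_sum_inner _ (stdBasis n),
      star_sum]
    refine Finset.sum_congr rfl fun i _ => ?_
    change inner ℂ (stdBasis n i) (star Z (stdBasis n i))
      = star (inner ℂ (stdBasis n i) (Z (stdBasis n i)))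
    rw [ContinuousLinearMap.star_eq_adjoint, ContinuousLinearMap.adjoint_inner_right]
    exact (inner_conj_symm _ _).symm
  have h1 := congrArg star h'
  rw [← hc, ← hc, star_mul, star_mul, star_star, star_star] at h1
  exact h1.symm

theorem trace_op_mul_comm (X Y : Op n) : LinearMap.trace ℂ (Fock n) (X * Y : Op n)
    = LinearMap.trace ℂ (Fock n) (Y * X : Op n) :=
  LinearMap.trace_mul_comm ℂ (X : Fock n →ₗ[ℂ] Fock n) Y

theorem star_rep_leftMul (hγ : IsMajorana γ) (W : Op n) :
    star (rep γ (leftMul W)) = rep γ (leftMul (star W)) := by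
  refine star_rep_eq hγ fun X Y => ?_
  change LinearMap.trace ℂ (Fock n) (star (W * X) * Y : Op n)
    = LinearMap.trace ℂ (Fock n) (star X * (star W * Y) : Op n)
  rw [star_mul, mul_assoc]

theorem star_rep_rightMul (hγ : IsMajorana γ) (W : Op n) :
    star (rep γ (rightMul W)) = rep γ (rightMul (star W)) := by
  refine star_rep_eq hγ fun X Y => ?_
  change LinearMap.trace ℂ (Fock n) (star (X * W) * Y : Op n)
    = LinearMap.trace ℂ (Fock n) (star X * (Y * star W) : Op n)
  rw [star_mul, mul_assoc, trace_op_mul_comm, mul_assoc]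

theorem PhiRight_one (hγ : IsMajorana γ) : PhiRight γ 1 = 1 := by
  rw [PhiRight_of_commute hγ (by simp), rightMul_one, rep_one hγ]

theorem Phi_add (X Y : SuperOp n) : Phi γ (X + Y) = Phi γ X + Phi γ Y := by
  simp only [Phi, add_apply, inner_add_right, add_smul,
    Finset.sum_add_distrib]

theorem Phi_smul (a : ℂ) (X : SuperOp n) : Phi γ (a • X) = a • Phi γ X := by
  simp only [Phi, smul_apply, inner_smul_right, mul_smul, Finset.smul_sum]

/-- `Φ` as a linear map. -/
def PhiLin (γ : Fin (2 * n) → Op n) : SuperOp n →ₗ[ℂ] Op' n where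
  toFun := Phi γ
  map_add' := Phi_add
  map_smul' := Phi_smul

theorem PhiLin_apply (X : SuperOp n) : PhiLin γ X = Phi γ X := rfl

theorem Phi_leftMul (hγ : IsMajorana γ) (W : Op n) : Phi γ (leftMul W) = rep γ (leftMul W) := by
  have := Phi_leftMul_rightMul (γ := γ) W 1
  rwa [rightMul_one, mul_one, PhiRight_one hγ, mul_one] at this

theorem Phi_rightMul (hγ : IsMajorana γ) (W : Op n) : Phi γ (rightMul W) = PhiRight γ W := by
  have := Phi_leftMul_rightMul (γ := γ) 1 W
  rwa [leftMul_one, one_mul, rep_one hγ, one_mul] at this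

end ThirdQuantization

/-! ### Normal modes of a quadratic Hamiltonian -/

section Modes

variable {n : ℕ} {γ : Fin (2 * n) → Op n} {h : Matrix (Fin (2 * n)) (Fin (2 * n)) ℂ}

instance (m : ℕ) : Nontrivial (Fock m) := by
  refine Module.nontrivial_of_finrank_pos (R := ℂ) ?_
  rw [finrank_fock]
  positivity

/-- The antisymmetric part of the coefficient matrix. -/
def antisymmPart {m : ℕ} (h : Matrix (Fin m) (Fin m) ℂ) : Matrix (Fin m) (Fin m) ℂ :=
  (1 / 2 : ℂ) • (h - h.transpose)

theorem antisymmPart_apply {m : ℕ} (h : Matrix (Fin m) (Fin m) ℂ) (j k : Fin m) :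
    antisymmPart h j k = (1 / 2 : ℂ) * (h j k - h k j) := rfl

theorem antisymmPart_swap {m : ℕ} (h : Matrix (Fin m) (Fin m) ℂ) (j k : Fin m) :
    antisymmPart h j k = -antisymmPart h k j := by
  rw [antisymmPart_apply, antisymmPart_apply]; ring

theorem IsMajorana.anticomm_smul (hγ : IsMajorana γ) (j k : Fin (2 * n)) :
    γ j * γ k + γ k * γ j = (if j = k then (2 : ℂ) else 0) • (1 : Op n) := by
  rw [hγ.anticomm]
  split_ifs
  · rw [ofNat_smul_eq_nsmul]; norm_num
  · rw [zero_smul]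

/-- `[H, γ_j] = 4 ∑_k A_{kj} γ_k`, where `A` is the antisymmetric part of `h`. -/
theorem IsMajorana.quadratic_mul (hγ : IsMajorana γ) (j : Fin (2 * n)) :
    quadratic γ h * γ j = γ j * quadratic γ h + ∑ k, (4 * antisymmPart h k j) • γ k := by
  have hterm : ∀ k l, (γ k * γ l) * γ j = γ j * (γ k * γ l)
      + ((if l = j then (2 : ℂ) else 0) • γ k - (if k = j then (2 : ℂ) else 0) • γ l) := by
    intro k l
    have h1 := congrArg (γ k * ·) (hγ.anticomm_smul l j)
    have h2 := congrArg (· * γ l) (hγ.anticomm_smul k j)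
    simp only [mul_smul_comm, smul_mul_assoc, mul_one, one_mul] at h1 h2
    rw [← h1, ← h2]
    noncomm_ring
  simp only [quadratic, Finset.sum_mul, Finset.mul_sum, smul_mul_assoc, mul_smul_comm, hterm,
    smul_add, Finset.sum_add_distrib, smul_sub, Finset.sum_sub_distrib, smul_smul]
  congr 1
  simp only [mul_ite, mul_zero, ite_smul, zero_smul, Finset.sum_ite_eq', Finset.mem_univ, if_true]
  rw [Finset.sum_comm (f := fun k l => if k = j then (h k l * 2) • γ l else 0)]
  simp only [Finset.sum_ite_eq', Finset.mem_univ, if_true]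
  rw [← Finset.sum_sub_distrib]
  refine Finset.sum_congr rfl fun k _ => ?_
  rw [← sub_smul, antisymmPart_apply]
  congr 1
  ring

/-- The linear combination `∑_j v_j γ_j`. -/
def combination (γ : Fin (2 * n) → Op n) (v : Fin (2 * n) → ℂ) : Op n := ∑ j, v j • γ j

theorem IsMajorana.combination_anticomm (hγ : IsMajorana γ) (v w : Fin (2 * n) → ℂ) :
    combination γ v * combination γ w + combination γ w * combination γ v
      = (2 * ∑ j, v j * w j) • (1 : Op n) := by
  simp only [combination, Finset.sum_mul, Finset.mul_sum, Finset.smul_sum, smul_mul_assoc,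
    mul_smul_comm, smul_smul]
  rw [Finset.sum_comm (f := fun j k => (v j * w k) • (γ k * γ j)), ← Finset.sum_add_distrib,
    Finset.sum_smul]
  refine Finset.sum_congr rfl fun j _ => ?_
  rw [← Finset.sum_add_distrib]
  simp only [mul_comm (w j), ← smul_add, hγ.anticomm_smul, smul_smul]
  rw [Finset.sum_eq_single j]
  · rw [if_pos rfl]; ring_nf
  · intro k _ hk
    rw [if_neg hk, mul_zero, zero_smul]
  · simp

theorem IsMajorana.star_combination (hγ : IsMajorana γ) (v : Fin (2 * n) → ℂ) :
    star (combination γ v) = combination γ (star v) := by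
  simp [combination, star_sum, star_smul, hγ.selfAdjoint]

/-- The anticommutator with `γ j` reads off twice the coefficient `v j`. -/
theorem IsMajorana.combination_injective (hγ : IsMajorana γ) :
    Function.Injective (combination γ) := by
  intro v w hvw
  ext j
  have h1 : ∀ v : Fin (2 * n) → ℂ, combination γ v * γ j + γ j * combination γ v
      = (2 * v j) • (1 : Op n) := by
    intro v
    have := hγ.combination_anticomm v (Pi.single j 1)
    have hs : combination γ (Pi.single j 1) = γ j := by
      simp [combination, Pi.single_apply, ite_smul]
    rw [hs] at this
    rw [this]
    simp [Pi.single_apply]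
  have h2 := h1 v
  rw [hvw, h1 w] at h2
  have h3 := smul_left_injective ℂ (one_ne_zero (α := Op n)) h2
  exact (mul_left_cancel₀ two_ne_zero h3).symm

/-- Taking adjoints in the formula for `[K, γ_j]` and comparing coefficients shows that `A` has
purely imaginary entries; an antisymmetric matrix with this property is Hermitian. The matrix `h`
itself need not be Hermitian. -/
theorem IsMajorana.antisymmPart_isHermitian (hγ : IsMajorana γ)
    (hK : IsSelfAdjoint (quadratic γ h)) : (antisymmPart h).IsHermitian := by
  ext j k
  rw [Matrix.conjTranspose_apply]
  have h1 := hγ.quadratic_mul (h := h) j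
  have h2 := congrArg star h1
  rw [star_add, star_mul, star_mul, hγ.selfAdjoint, hK.star_eq] at h2
  have h3 : combination γ (fun k => 4 * antisymmPart h k j)
      = -combination γ (star fun k => 4 * antisymmPart h k j) := by
    rw [← hγ.star_combination]
    change _ = -star (∑ k, (4 * antisymmPart h k j) • γ k)
    rw [h1] at h2
    exact eq_neg_of_add_eq_zero_left (by simpa [add_assoc, combination] using h2.symm)
  have h4 : -combination γ (star fun k => 4 * antisymmPart h k j)
      = combination γ (-star fun k => 4 * antisymmPart h k j) := by
    simp [combination]
  have h5 := congrFun (hγ.combination_injective (h3.trans h4)) k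
  simp only [Pi.neg_apply, Pi.star_apply, star_mul', star_ofNat] at h5
  rw [antisymmPart_swap h j k]
  linear_combination (1 / 4 : ℂ) * h5

/-- The normal mode `b_k = ∑_j U_{jk} γ_j`. -/
def mode (γ : Fin (2 * n) → Op n) (U : Matrix (Fin (2 * n)) (Fin (2 * n)) ℂ) (k : Fin (2 * n)) :
    Op n :=
  combination γ fun j => U j k

/-- `U` diagonalizes the adjoint action of `K` on Majorana operators, with energies `4 ε_k`. -/
structure IsModeMatrix (γ : Fin (2 * n) → Op n) (K : Op n)
    (U : Matrix (Fin (2 * n)) (Fin (2 * n)) ℂ) (ε : Fin (2 * n) → ℝ) : Prop where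
  unitary : U ∈ Matrix.unitaryGroup (Fin (2 * n)) ℂ
  comm : ∀ k, K * mode γ U k = mode γ U k * K + (4 * ε k : ℂ) • mode γ U k

theorem IsMajorana.isModeMatrix (hγ : IsMajorana γ) (hA : (antisymmPart h).IsHermitian) :
    IsModeMatrix γ (quadratic γ h)
      (hA.eigenvectorUnitary).1 hA.eigenvalues where
  unitary := hA.eigenvectorUnitary.2
  comm k := by
    set U : Matrix (Fin (2 * n)) (Fin (2 * n)) ℂ := (hA.eigenvectorUnitary).1 with hU
    have heig : ∀ i, ∑ j, antisymmPart h i j * U j k = (hA.eigenvalues k : ℂ) * U i k := by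
      intro i
      have := congrFun (hA.mulVec_eigenvectorBasis k) i
      simpa [Matrix.mulVec, dotProduct, hU, Matrix.IsHermitian.eigenvectorUnitary_apply] using this
    simp only [mode, combination, Finset.mul_sum, Finset.sum_mul, mul_smul_comm, smul_mul_assoc,
      hγ.quadratic_mul, smul_add, Finset.sum_add_distrib, Finset.smul_sum, smul_smul]
    congr 1
    rw [Finset.sum_comm]
    refine Finset.sum_congr rfl fun i _ => ?_
    rw [← Finset.sum_smul, mul_assoc, ← heig, Finset.mul_sum]
    congr 1
    exact Finset.sum_congr rfl fun j _ => by ring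

variable {K : Op n} {U : Matrix (Fin (2 * n)) (Fin (2 * n)) ℂ} {ε : Fin (2 * n) → ℝ}

theorem IsModeMatrix.star_mul_self (hU : IsModeMatrix γ K U ε) (k l : Fin (2 * n)) :
    ∑ j, star (U j k) * U j l = if k = l then 1 else 0 := by
  have := congrFun (congrFun (Matrix.mem_unitaryGroup_iff'.1 hU.unitary) k) l
  rwa [Matrix.mul_apply, Matrix.one_apply] at this

theorem IsModeMatrix.mul_star_self (hU : IsModeMatrix γ K U ε) (i j : Fin (2 * n)) :
    ∑ k, U i k * star (U j k) = if i = j then 1 else 0 := by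
  have := congrFun (congrFun (Matrix.mem_unitaryGroup_iff.1 hU.unitary) i) j
  rwa [Matrix.mul_apply, Matrix.one_apply] at this

/-- Each `γ j` has two expansions, one in the modes and, by self-adjointness, one in their adjoints.
Using one of each in a product produces coefficients `star (U j k) * U j l`, which sum over `j` to a
Kronecker delta. -/
theorem IsModeMatrix.sum_mode (hU : IsModeMatrix γ K U ε) (j : Fin (2 * n)) :
    ∑ k, star (U j k) • mode γ U k = γ j := by
  simp only [mode, combination, Finset.smul_sum, smul_smul]
  rw [Finset.sum_comm]
  simp only [← Finset.sum_smul, mul_comm (star _), hU.mul_star_self]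
  simp [ite_smul]

theorem IsModeMatrix.sum_star_mode (hU : IsModeMatrix γ K U ε) (hγ : IsMajorana γ)
    (j : Fin (2 * n)) : ∑ k, U j k • star (mode γ U k) = γ j := by
  have := congrArg star (hU.sum_mode j)
  rw [hγ.selfAdjoint] at this
  simpa [star_sum, star_smul] using this

theorem IsModeMatrix.mode_anticomm_star (hU : IsModeMatrix γ K U ε) (hγ : IsMajorana γ)
    (k l : Fin (2 * n)) :
    mode γ U k * star (mode γ U l) + star (mode γ U l) * mode γ U k
      = (if k = l then (2 : ℂ) else 0) • (1 : Op n) := by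
  rw [mode, mode, hγ.star_combination, hγ.combination_anticomm]
  have := hU.star_mul_self l k
  simp only [Pi.star_apply, mul_comm (U _ k), this, eq_comm (a := l)]
  split_ifs <;> simp

/-- The bilinear overlap of two modes. -/
def overlap (U : Matrix (Fin (2 * n)) (Fin (2 * n)) ℂ) (k l : Fin (2 * n)) : ℂ :=
  ∑ j, U j k * U j l

theorem overlap_comm (k l : Fin (2 * n)) : overlap U k l = overlap U l k :=
  Finset.sum_congr rfl fun _ _ => mul_comm _ _

theorem IsMajorana.mode_anticomm (hγ : IsMajorana γ) (k l : Fin (2 * n)) :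
    mode γ U k * mode γ U l + mode γ U l * mode γ U k = (2 * overlap U k l) • (1 : Op n) :=
  hγ.combination_anticomm _ _

/-- The anticommutator of two modes is a scalar, so it commutes with `K`; but it also carries energy
`4 (ε k + ε l)`. -/
theorem IsModeMatrix.overlap_eq_zero (hU : IsModeMatrix γ K U ε) (hγ : IsMajorana γ)
    {k l : Fin (2 * n)} (hkl : ε k + ε l ≠ 0) : overlap U k l = 0 := by
  have h1 : ∀ k l, K * (mode γ U k * mode γ U l) = mode γ U k * mode γ U l * K
      + (4 * (ε k + ε l) : ℂ) • (mode γ U k * mode γ U l) := by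
    intro k l
    rw [← mul_assoc, hU.comm, add_mul, mul_assoc, hU.comm, mul_add, smul_mul_assoc,
      mul_smul_comm, add_assoc, ← add_smul, mul_assoc]
    congr 2
    ring
  have h2 := congrArg₂ (· + ·) (h1 k l) (h1 l k)
  rw [← mul_add, add_add_add_comm, ← add_mul, add_comm (ε l : ℂ), ← smul_add,
    hγ.mode_anticomm] at h2
  rw [mul_smul_comm, smul_mul_assoc, mul_one, one_mul, left_eq_add, smul_smul] at h2
  have h3 := (smul_eq_zero.1 h2).resolve_right one_ne_zero
  have h4 : (ε k + ε l : ℂ) ≠ 0 := by exact_mod_cast hkl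
  simpa [h4] using h3

theorem IsModeMatrix.star_mode (hU : IsModeMatrix γ K U ε) (hγ : IsMajorana γ)
    (k : Fin (2 * n)) : star (mode γ U k) = ∑ l, star (overlap U k l) • mode γ U l := by
  have h1 : star (mode γ U k) = ∑ j, star (U j k) • γ j := hγ.star_combination _
  rw [h1]
  simp only [← hU.sum_mode, Finset.smul_sum, smul_smul]
  rw [Finset.sum_comm]
  refine Finset.sum_congr rfl fun l _ => ?_
  rw [← Finset.sum_smul]
  simp [overlap, star_sum]

theorem IsModeMatrix.comm_star (hU : IsModeMatrix γ K U ε) (hK : IsSelfAdjoint K)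
    (k : Fin (2 * n)) : K * star (mode γ U k)
      = star (mode γ U k) * K + (-(4 * ε k) : ℂ) • star (mode γ U k) := by
  have := congrArg star (hU.comm k)
  rw [star_add, star_mul, star_mul, hK.star_eq, star_smul] at this
  rw [this]
  simp

/-- Complex conjugation maps modes of energy `ε` to modes of energy `-ε`. -/
theorem IsModeMatrix.sum_swap (hU : IsModeMatrix γ K U ε) (hγ : IsMajorana γ)
    {M : Type*} [AddCommGroup M] [Module ℂ M] (B : Op n →ₗ[ℂ] Op n →ₗ[ℂ] M) (g : ℝ → ℂ) :
    ∑ k, g (-ε k) • B (star (mode γ U k)) (mode γ U k)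
      = ∑ k, g (ε k) • B (mode γ U k) (star (mode γ U k)) := by
  have h1 : ∀ k, g (-ε k) • B (star (mode γ U k)) (mode γ U k)
      = ∑ l, g (ε l) • B (mode γ U l) (star (overlap U k l) • mode γ U k) := by
    intro k
    rw [hU.star_mode hγ k, map_sum, LinearMap.sum_apply, Finset.smul_sum]
    refine Finset.sum_congr rfl fun l _ => ?_
    rw [map_smul, LinearMap.smul_apply, map_smul]
    -- Only pairs with `ε l = -ε k` overlap, so the weight `g (-ε k)` may be replaced by `g (ε l)`.
    -- By symmetry of the overlap, the sum over `k` then reassembles `star (mode γ U l)`.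
    by_cases hkl : ε k + ε l = 0
    · rw [show -ε k = ε l by linarith]
    · simp [hU.overlap_eq_zero hγ hkl]
  simp only [h1]
  rw [Finset.sum_comm]
  refine Finset.sum_congr rfl fun l _ => ?_
  rw [← Finset.smul_sum, ← map_sum, hU.star_mode hγ l]
  simp only [overlap_comm]

end Modes

/-! ### Scalar integrals -/

section Scalar

/-- The Fourier transform of the filter function `f`. -/
def filterHat (β ν : ℝ) : ℝ :=
  1 / √(2 * Real.pi) * (1 / √(β * √(Real.pi / 2))) * (√Real.pi * β) *
    Real.exp (-(β ^ 2 * ν ^ 2) / 4)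

theorem filterHat_neg (β ν : ℝ) : filterHat β (-ν) = filterHat β ν := by
  rw [filterHat, filterHat, neg_sq]

theorem filter_integrand_eq (β ν t : ℝ) :
    (filterF β t : ℂ) * Complex.exp (-Complex.I * ν * t)
      = ((1 / √(β * √(Real.pi / 2)) : ℝ) : ℂ) *
        Complex.exp (-((1 / β ^ 2 : ℝ) : ℂ) * (t : ℂ) ^ 2 + (-Complex.I * ν) * t + 0) := by
  rw [filterF, Complex.ofReal_mul, mul_assoc, Complex.ofReal_exp, ← Complex.exp_add]
  congr 2
  push_cast
  ring

theorem integrable_filter {β : ℝ} (hβ : 0 < β) (ν : ℝ) :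
    Integrable fun t : ℝ => (filterF β t : ℂ) * Complex.exp (-Complex.I * ν * t) := by
  simp only [filter_integrand_eq]
  refine (integrable_cexp_quadratic ?_ _ _).const_mul _
  rw [Complex.ofReal_re]
  positivity

theorem integral_filter {β : ℝ} (hβ : 0 < β) (ν : ℝ) :
    ((1 / √(2 * Real.pi) : ℝ) : ℂ) *
      ∫ t : ℝ, (filterF β t : ℂ) * Complex.exp (-Complex.I * ν * t) = filterHat β ν := by
  simp only [filter_integrand_eq]
  have hb : (-((1 / β ^ 2 : ℝ) : ℂ)).re < 0 := by
    rw [Complex.neg_re, Complex.ofReal_re, neg_lt_zero]; positivity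
  rw [integral_const_mul, integral_cexp_quadratic hb]
  have h1 : ((Real.pi : ℂ) / - -((1 / β ^ 2 : ℝ) : ℂ)) ^ (1 / 2 : ℂ)
      = ((√Real.pi * β : ℝ) : ℂ) := by
    have : (Real.pi : ℂ) / - -((1 / β ^ 2 : ℝ) : ℂ) = ((Real.pi * β ^ 2 : ℝ) : ℂ) := by
      push_cast; rw [neg_neg, one_div, div_inv_eq_mul]
    rw [this, show (1 / 2 : ℂ) = ((1 / 2 : ℝ) : ℂ) by norm_num,
      ← Complex.ofReal_cpow (by positivity), ← Real.sqrt_eq_rpow,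
      Real.sqrt_mul Real.pi_pos.le, Real.sqrt_sq hβ.le]
  have h2 : (0 : ℂ) - (-Complex.I * ν) ^ 2 / (4 * -((1 / β ^ 2 : ℝ) : ℂ))
      = ((-(β ^ 2 * ν ^ 2) / 4 : ℝ) : ℂ) := by
    have hβ' : (β : ℂ) ≠ 0 := by exact_mod_cast hβ.ne'
    push_cast
    rw [mul_pow, neg_sq, Complex.I_sq]
    field_simp
    ring
  rw [h1, h2, filterHat, ← Complex.ofReal_exp]
  push_cast
  ring

/-- The factor `exp (- β e) f̂ (ω - 4 e)` of a mode of energy `e` in `Ã(ω)`. -/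
def jumpFactor (β e ω : ℝ) : ℝ := Real.exp (-(β * e)) * filterHat β (ω - 4 * e)

theorem continuous_jumpFactor (β e : ℝ) : Continuous (jumpFactor β e) := by
  unfold jumpFactor filterHat
  fun_prop

theorem abs_filterHat_le (β ν : ℝ) : |filterHat β ν| ≤ |filterHat β 0| := by
  set A : ℝ := 1 / √(2 * Real.pi) * (1 / √(β * √(Real.pi / 2))) * (√Real.pi * β) with hA
  rw [filterHat, filterHat, ← hA, abs_mul, abs_mul A, Real.abs_exp, Real.abs_exp]
  refine mul_le_mul_of_nonneg_left (Real.exp_le_exp.2 ?_) (abs_nonneg A)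
  nlinarith [mul_self_nonneg (β * ν)]

theorem abs_jumpFactor_le (β e ω : ℝ) :
    |jumpFactor β e ω| ≤ Real.exp (-(β * e)) * |filterHat β 0| := by
  rw [jumpFactor, abs_mul, Real.abs_exp]
  exact mul_le_mul_of_nonneg_left (abs_filterHat_le _ _) (Real.exp_pos _).le

theorem integrable_eta {β : ℝ} (hβ : 0 < β) : Integrable (eta β) := by
  have h := (integrable_exp_neg_mul_sq (by positivity : 0 < β ^ 2 / 2)).comp_add_right (1 / β)
  convert h using 2 with ω
  rw [eta]
  congr 1
  field_simp

theorem integrable_eta_mul {β : ℝ} (hβ : 0 < β) {p q : ℝ → ℝ} (hp : Continuous p)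
    (hq : Continuous q) {P Q : ℝ} (hP : ∀ ω, |p ω| ≤ P) (hQ : ∀ ω, |q ω| ≤ Q) :
    Integrable fun ω => eta β ω * (p ω * q ω) := by
  have h := (integrable_eta hβ).bdd_mul (f := fun ω => p ω * q ω) (c := P * Q)
    (hp.mul hq).aestronglyMeasurable (ae_of_all _ fun ω => by
      rw [Real.norm_eq_abs, abs_mul]
      exact mul_le_mul (hP ω) (hQ ω) (abs_nonneg _) ((abs_nonneg _).trans (hP ω)))
  simpa only [mul_comm] using h

/-- The transition rate `θ(ε)`. -/
def rate (β ε : ℝ) : ℝ := √2 / 2 * Real.exp (-1 / 4) * Real.exp (-4 * β ^ 2 * ε ^ 2)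

theorem rate_pos (β ε : ℝ) : 0 < rate β ε := by unfold rate; positivity

theorem rate_neg (β ε : ℝ) : rate β (-ε) = rate β ε := by rw [rate, rate, neg_sq]

/-- Completing the square: the exponents of `η` and of the squared filter add up to `-β² (ω + (1 +
4βε)/(2β))² - (4βε - 1)²/4`. The constant term supplies `exp(-1/4 - 4β²ε² + 2βε)`, and the prefactor
collapses to `√2/2`. -/
theorem integral_eta_filterHat {β : ℝ} (hβ : 0 < β) (ε : ℝ) :
    ∫ ω, eta β ω * (filterHat β (ω + 4 * ε) * filterHat β (ω + 4 * ε))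
      = rate β ε * Real.exp (2 * β * ε) := by
  set A : ℝ := 1 / √(2 * Real.pi) * (1 / √(β * √(Real.pi / 2))) * (√Real.pi * β) with hA
  have h1 : ∀ ω, eta β ω * (filterHat β (ω + 4 * ε) * filterHat β (ω + 4 * ε))
      = A ^ 2 * Real.exp (-(4 * β * ε - 1) ^ 2 / 4) *
        Real.exp (-(β ^ 2) * (ω + (1 + 4 * β * ε) / (2 * β)) ^ 2) := by
    intro ω
    rw [eta, filterHat, ← hA]
    have : Real.exp (-(β * ω + 1) ^ 2 / 2) * (Real.exp (-(β ^ 2 * (ω + 4 * ε) ^ 2) / 4) *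
        Real.exp (-(β ^ 2 * (ω + 4 * ε) ^ 2) / 4)) = Real.exp (-(4 * β * ε - 1) ^ 2 / 4) *
        Real.exp (-(β ^ 2) * (ω + (1 + 4 * β * ε) / (2 * β)) ^ 2) := by
      rw [← Real.exp_add, ← Real.exp_add, ← Real.exp_add]
      congr 1
      field_simp
      ring
    rw [mul_assoc (A ^ 2), ← this]
    ring
  simp only [h1]
  rw [integral_const_mul, integral_add_right_eq_self (fun ω => Real.exp (-(β ^ 2) * ω ^ 2)),
    integral_gaussian, Real.sqrt_div Real.pi_pos.le, Real.sqrt_sq hβ.le]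
  have h2 : A ^ 2 * (√Real.pi / β) = √2 / 2 := by
    have hp := Real.pi_pos
    have e1 : √(2 * Real.pi) ^ 2 = 2 * Real.pi := Real.sq_sqrt (by positivity)
    have e2 : √(β * √(Real.pi / 2)) ^ 2 = β * √(Real.pi / 2) := Real.sq_sqrt (by positivity)
    have e3 : √Real.pi ^ 2 = Real.pi := Real.sq_sqrt hp.le
    rw [hA, mul_pow, mul_pow, div_pow, div_pow, e1, e2, mul_pow, e3, Real.sqrt_div hp.le]
    have e4 : √Real.pi ≠ 0 := (Real.sqrt_pos.2 hp).ne'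
    field_simp
  have h3 : Real.exp (-(4 * β * ε - 1) ^ 2 / 4)
      = Real.exp (-1 / 4) * Real.exp (-4 * β ^ 2 * ε ^ 2) * Real.exp (2 * β * ε) := by
    rw [← Real.exp_add, ← Real.exp_add]
    congr 1
    ring
  rw [mul_right_comm, h2, h3, rate]
  ring

/-- The Gibbs factors of the energies `ε` and `-ε` cancel. -/
theorem integral_eta_mixed {β : ℝ} (hβ : 0 < β) (ε : ℝ) :
    ∫ ω, eta β ω * (jumpFactor β ε (-ω) * jumpFactor β (-ε) ω)
      = rate β ε * Real.exp (2 * β * ε) := by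
  rw [← integral_eta_filterHat hβ]
  refine integral_congr_ae (ae_of_all _ fun ω => ?_)
  simp only [jumpFactor]
  have h1 : filterHat β (-ω - 4 * ε) = filterHat β (ω + 4 * ε) := by
    rw [← filterHat_neg]; congr 1; ring
  have h2 : Real.exp (-(β * ε)) * Real.exp (-(β * -ε)) = 1 := by
    rw [← Real.exp_add]; simp
  rw [h1, show ω - 4 * -ε = ω + 4 * ε by ring]
  linear_combination eta β ω * filterHat β (ω + 4 * ε) ^ 2 * h2

/-- Here the two Gibbs factors combine to `exp(-2βε)` and cancel the asymmetry of the Gaussian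
integral. The resulting rate is even in `ε`, which the symmetrization under conjugation needs later.
-/
theorem integral_eta_diag {β : ℝ} (hβ : 0 < β) (ε : ℝ) :
    ∫ ω, eta β ω * (jumpFactor β ε (-ω) * jumpFactor β ε (-ω)) = rate β ε := by
  have h0 : ∀ ω, eta β ω * (jumpFactor β ε (-ω) * jumpFactor β ε (-ω))
      = Real.exp (-(2 * β * ε)) *
        (eta β ω * (filterHat β (ω + 4 * ε) * filterHat β (ω + 4 * ε))) := by
    intro ω
    have h1 : filterHat β (-ω - 4 * ε) = filterHat β (ω + 4 * ε) := by
      rw [← filterHat_neg]; congr 1; ring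
    have h2 : Real.exp (-(2 * β * ε)) = Real.exp (-(β * ε)) * Real.exp (-(β * ε)) := by
      rw [← Real.exp_add]; congr 1; ring
    rw [jumpFactor, h1, h2]
    ring
  simp only [h0]
  rw [integral_const_mul, integral_eta_filterHat hβ, mul_left_comm, ← Real.exp_add]
  simp

/-- With `y = 2πs`, the bounds `exp |y| ≥ 1 + |y| + y²/2` and `exp(-|y|) ≥ 1 - |y|` give `cosh y ≥ 1
+ y²/4`, and `π² ≥ 1`. This crude bound serves for integrability only. -/
theorem one_add_sq_le_cosh (s : ℝ) : 1 + s ^ 2 ≤ Real.cosh (2 * Real.pi * s) := by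
  have h1 := Real.quadratic_le_exp_of_nonneg (abs_nonneg (2 * Real.pi * s))
  have h2 := Real.add_one_le_exp (-|2 * Real.pi * s|)
  rw [← Real.cosh_abs, Real.cosh_eq]
  rw [sq_abs] at h1
  have h3 : 3 < Real.pi := Real.pi_gt_three
  nlinarith [mul_nonneg (sq_nonneg s) (by nlinarith : 0 ≤ Real.pi ^ 2 - 1)]

/-- Up to a constant `b₁` is the convolution of two integrable functions. -/
theorem integrable_b₁ : Integrable b₁ := by
  have h1 : Integrable fun s : ℝ => 1 / Real.cosh (2 * Real.pi * s) := by
    refine integrable_inv_one_add_sq.mono' ?_ (ae_of_all _ fun s => ?_)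
    · refine Continuous.aestronglyMeasurable ?_
      exact continuous_const.div (by fun_prop) fun s => (Real.cosh_pos _).ne'
    · rw [Real.norm_eq_abs, abs_of_pos (by positivity), one_div]
      exact inv_anti₀ (by positivity) (one_add_sq_le_cosh s)
  have h2 : Integrable fun s : ℝ => Real.sin (-s) * Real.exp (-2 * s ^ 2) :=
    (integrable_exp_neg_mul_sq (by norm_num : (0 : ℝ) < 2)).bdd_mul (c := 1)
      (Continuous.aestronglyMeasurable (by fun_prop))
      (ae_of_all _ fun s => Real.abs_sin_le_one _)
  have h3 := (h1.integrable_convolution (ContinuousLinearMap.mul ℝ ℝ) h2).const_mul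
    (2 * √Real.pi * Real.exp (1 / 8))
  exact h3

theorem b₁_neg (t : ℝ) : b₁ (-t) = -b₁ t := by
  rw [b₁, b₁, ← mul_neg, ← integral_neg, ← integral_neg_eq_self]
  congr 1
  refine integral_congr_ae (ae_of_all _ fun s => ?_)
  simp only
  rw [mul_neg, Real.cosh_neg, show -t - -s = -(t - s) by ring, neg_neg, neg_sq, Real.sin_neg]
  ring

theorem integral_b₁ : ∫ t, b₁ t = 0 := by
  have h := integral_neg_eq_self b₁ volume
  simp only [b₁_neg, integral_neg] at h
  linarith

theorem integrable_b₂_mul (c : ℂ) : Integrable fun t : ℝ => b₂ t * Complex.exp (c * t) := by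
  have h := (integrable_cexp_quadratic (b := 4) (by norm_num) (-2 * Complex.I + c) 0).const_mul
    (1 / (2 * Real.pi ^ (3 / 2 : ℝ) : ℝ) : ℂ)
  refine h.congr (ae_of_all _ fun t => ?_)
  simp only [b₂]
  rw [mul_assoc, ← Complex.exp_add]
  congr 2
  ring

end Scalar

/-! ### Heisenberg evolution of modes -/

section Evolution

variable {n : ℕ} {K W : Op n} {e : ℝ}

theorem exp_mul_mul_exp_neg {e : ℂ} (hW : K * W = W * K + e • W) (z : ℂ) :
    NormedSpace.exp (z • K) * W * NormedSpace.exp ((-z) • K) = Complex.exp (z * e) • W := by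
  let : NormedAlgebra ℚ (Op n) := NormedAlgebra.restrictScalars ℚ ℂ (Op n)
  -- The eigenvalue relation says that `W` intertwines `-zK - ze` with `-zK`. Exponentiating, the
  -- central summand splits off as a scalar.
  have hs : SemiconjBy W ((-z) • K + algebraMap ℂ (Op n) (-(z * e))) ((-z) • K) := by
    rw [SemiconjBy, mul_add, mul_smul_comm, smul_mul_assoc, hW, smul_add, smul_smul,
      ← Algebra.commutes, ← Algebra.smul_def, neg_mul]
  have h1 := hs.exp_neg_mul_mul_exp_eq_self
  rw [NormedSpace.exp_add_of_commute (Algebra.commutes _ _).symm,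
    ← NormedSpace.algebraMap_exp_comm, ← neg_smul, neg_neg, ← mul_assoc, ← Algebra.commutes,
    ← Algebra.smul_def, ← Complex.exp_eq_exp_ℂ] at h1
  have h2 := congrArg (Complex.exp (z * e) • ·) h1
  simp only [smul_smul, ← Complex.exp_add] at h2
  simpa using h2

theorem heisenberg_eigen (hW : K * W = W * K + (4 * e : ℂ) • W) (t : ℝ) :
    heisenberg K W t = Complex.exp (4 * Complex.I * e * t) • W := by
  have := exp_mul_mul_exp_neg hW (Complex.I * t)
  rw [heisenberg, neg_mul, this]
  congr 2
  ring

theorem gibbsConj_eigen (hW : K * W = W * K + (4 * e : ℂ) • W) (β : ℝ) :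
    gibbsConj β K W = (Real.exp (-(β * e)) : ℂ) • W := by
  have := exp_mul_mul_exp_neg hW (-(β : ℂ) / 4)
  rw [neg_div, neg_neg] at this
  rw [gibbsConj, neg_div, this]
  congr 1
  push_cast
  congr 1
  ring

theorem heisenberg_sum {ι : Type*} (s : Finset ι) (c : ι → ℂ) (W : ι → Op n) (t : ℝ) :
    heisenberg K (∑ k ∈ s, c k • W k) t = ∑ k ∈ s, c k • heisenberg K (W k) t := by
  simp only [heisenberg, Finset.mul_sum, Finset.sum_mul, mul_smul_comm, smul_mul_assoc]

theorem gibbsConj_sum {ι : Type*} (s : Finset ι) (β : ℝ) (c : ι → ℂ) (W : ι → Op n) :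
    gibbsConj β K (∑ k ∈ s, c k • W k) = ∑ k ∈ s, c k • gibbsConj β K (W k) := by
  simp only [gibbsConj, Finset.mul_sum, Finset.sum_mul, mul_smul_comm, smul_mul_assoc]

/-- The expansion of `γ j` into eigenoperators is left free because two are used: modes with
energies `ε k`, and their adjoints with energies `-ε k`. The time integral shifts the filter's
Fourier transform by `4 e k`. -/
theorem jumpTilde_eq {γ : Fin (2 * n) → Op n} {β : ℝ} (hβ : 0 < β) {ι : Type*} [Fintype ι]
    {c : ι → ℂ} {W : ι → Op n} {e : ι → ℝ}
    (hW : ∀ k, K * W k = W k * K + (4 * e k : ℂ) • W k) (j : Fin (2 * n))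
    (hj : γ j = ∑ k, c k • W k) (ω : ℝ) :
    jumpTilde γ β K j ω = ∑ k, (c k * jumpFactor β (e k) ω : ℂ) • W k := by
  have h1 : ∀ t : ℝ, ((filterF β t : ℂ) * Complex.exp (-Complex.I * ω * t)) • heisenberg K (γ j) t
      = ∑ k, ((filterF β t : ℂ) * Complex.exp (-Complex.I * (ω - 4 * e k : ℝ) * t)) •
        (c k • W k) := by
    intro t
    rw [hj, heisenberg_sum, Finset.smul_sum]
    refine Finset.sum_congr rfl fun k _ => ?_
    rw [heisenberg_eigen (hW k), smul_comm (c k), smul_smul, mul_assoc, ← Complex.exp_add]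
    congr 3
    push_cast
    ring
  rw [jumpTilde]
  simp only [h1]
  rw [integral_finsetSum _ fun k _ => (integrable_filter hβ _).smul_const _]
  simp only [integral_smul_const]
  rw [← Complex.coe_smul, Finset.smul_sum]
  simp only [smul_smul, ← mul_assoc]
  simp only [integral_filter hβ]
  rw [gibbsConj_sum]
  refine Finset.sum_congr rfl fun k _ => ?_
  rw [gibbsConj_eigen (hW k), smul_smul, jumpFactor]
  congr 1
  push_cast
  ring

end Evolution

/-! ### The free parent Hamiltonian in normal modes -/

section Parent

variable {n : ℕ} {γ : Fin (2 * n) → Op n} {K : Op n}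
  {U : Matrix (Fin (2 * n)) (Fin (2 * n)) ℂ} {ε : Fin (2 * n) → ℝ}

section ModeSum

set_option linter.unusedSectionVars false

variable {V : Type*} [NormedAddCommGroup V] [NormedSpace ℂ V] [CompleteSpace V]

theorem integrable_modeSum (U : Matrix (Fin (2 * n)) (Fin (2 * n)) ℂ)
    {c : Fin (2 * n) → Fin (2 * n) → ℝ → ℂ} (hc : ∀ k l, Integrable (c k l))
    (X : Fin (2 * n) → Fin (2 * n) → V) (j : Fin (2 * n)) :
    Integrable fun ω => ∑ k, ∑ l, (star (U j k) * U j l * c k l ω) • X k l :=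
  integrable_finsetSum _ fun k _ => integrable_finsetSum _ fun l _ =>
    ((hc k l).const_mul _).smul_const _

theorem integral_modeSum (U : Matrix (Fin (2 * n)) (Fin (2 * n)) ℂ)
    {c : Fin (2 * n) → Fin (2 * n) → ℝ → ℂ} (hc : ∀ k l, Integrable (c k l))
    (X : Fin (2 * n) → Fin (2 * n) → V) (j : Fin (2 * n)) :
    ∫ ω, ∑ k, ∑ l, (star (U j k) * U j l * c k l ω) • X k l
      = ∑ k, ∑ l, (star (U j k) * U j l * ∫ ω, c k l ω) • X k l := by
  rw [integral_finsetSum _ fun k _ => integrable_finsetSum _ fun l _ =>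
    ((hc k l).const_mul _).smul_const _]
  refine Finset.sum_congr rfl fun k _ => ?_
  rw [integral_finsetSum _ fun l _ => ((hc k l).const_mul _).smul_const _]
  refine Finset.sum_congr rfl fun l _ => ?_
  rw [integral_smul_const, integral_const_mul]

/-- Orthonormality of the columns of `U` keeps only the diagonal `k = l`. -/
theorem IsModeMatrix.sum_modeSum (hU : IsModeMatrix γ K U ε) (c : Fin (2 * n) → Fin (2 * n) → ℂ)
    (X : Fin (2 * n) → Fin (2 * n) → V) :
    ∑ j, ∑ k, ∑ l, (star (U j k) * U j l * c k l) • X k l = ∑ k, c k k • X k k := by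
  rw [Finset.sum_comm]
  refine Finset.sum_congr rfl fun k _ => ?_
  rw [Finset.sum_comm]
  simp only [← Finset.sum_smul, ← Finset.sum_mul, hU.star_mul_self]
  simp [ite_smul]

theorem IsModeMatrix.sum_integral_modeSum (hU : IsModeMatrix γ K U ε)
    {c : Fin (2 * n) → Fin (2 * n) → ℝ → ℂ} (hc : ∀ k l, Integrable (c k l))
    (X : Fin (2 * n) → Fin (2 * n) → V) :
    ∑ j, ∫ ω, ∑ k, ∑ l, (star (U j k) * U j l * c k l ω) • X k l
      = ∑ k, (∫ ω, c k k ω) • X k k := by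
  simp only [integral_modeSum U hc]
  exact hU.sum_modeSum (fun k l => ∫ ω, c k l ω) X

end ModeSum

theorem IsModeMatrix.comm_star' (hU : IsModeMatrix γ K U ε) (hK : IsSelfAdjoint K)
    (k : Fin (2 * n)) : K * star (mode γ U k)
      = star (mode γ U k) * K + (4 * ((-ε k : ℝ) : ℂ)) • star (mode γ U k) := by
  rw [hU.comm_star hK]
  congr 2
  push_cast
  ring

theorem heisenberg_expand {ι : Type*} [Fintype ι] {c : ι → ℂ} {W : ι → Op n} {e : ι → ℝ}
    (hW : ∀ k, K * W k = W k * K + (4 * e k : ℂ) • W k) {j : Fin (2 * n)}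
    (hj : γ j = ∑ k, c k • W k) (t : ℝ) :
    heisenberg K (γ j) t = ∑ k, (c k * Complex.exp (4 * Complex.I * e k * t)) • W k := by
  rw [hj, heisenberg_sum]
  exact Finset.sum_congr rfl fun k _ => by rw [heisenberg_eigen (hW k), smul_smul]

theorem sum_smul_mul_sum_smul {ι A : Type*} [Fintype ι] [Ring A] [Algebra ℂ A] (p q : ι → ℂ)
    (X Y : ι → A) : (∑ k, p k • X k) * ∑ l, q l • Y l = ∑ k, ∑ l, (p k * q l) • (X k * Y l) := by
  simp only [Finset.sum_mul_sum, smul_mul_smul_comm]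

theorem superOp_real_smul (r : ℝ) (S : SuperOp n) : r • S = (r : ℂ) • S := by
  ext1 X
  exact (Complex.coe_smul r (S X)).symm

theorem leftMul_sum_smul {ι : Type*} (s : Finset ι) (c : ι → ℂ) (W : ι → Op n) :
    leftMul (∑ k ∈ s, c k • W k) = ∑ k ∈ s, c k • leftMul (W k) := by
  simp only [leftMul, map_sum, map_smul]

theorem rightMul_sum_smul {ι : Type*} (s : Finset ι) (c : ι → ℂ) (W : ι → Op n) :
    rightMul (∑ k ∈ s, c k • W k) = ∑ k ∈ s, c k • rightMul (W k) := by
  simp only [rightMul, map_sum, map_smul]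

/-- The coherent terms sum up to zero. -/
theorem IsModeMatrix.sum_coherentTilde (hU : IsModeMatrix γ K U ε) (hγ : IsMajorana γ)
    (hK : IsSelfAdjoint K) (β : ℝ) : ∑ j, coherentTilde γ β K j = 0 := by
  set X : Fin (2 * n) → Fin (2 * n) → Op n := fun k l => mode γ U k * star (mode γ U l) with hX
  -- With modes in the first factor and adjoint modes in the second, the phase `4iβ (ε_k (t' - t) +
  -- ε_l (t + t'))` separates into a part in `t` and a part in `t'`.
  set P : Fin (2 * n) → Fin (2 * n) → ℝ → ℂ := fun k l t =>
    Complex.exp (4 * Complex.I * β * (ε l - ε k) * t) with hP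
  set Q : Fin (2 * n) → Fin (2 * n) → ℝ → ℂ := fun k l t' =>
    b₂ t' * Complex.exp ((4 * Complex.I * β * (ε k + ε l)) * t') with hQ
  have hQi : ∀ k l, Integrable (Q k l) := fun k l => integrable_b₂_mul _
  have h1 : ∀ j (t t' : ℝ), b₂ t' •
      (heisenberg K (γ j) (β * (t' - t)) * heisenberg K (γ j) (-β * (t + t')))
      = ∑ k, ∑ l, (star (U j k) * U j l * (P k l t * Q k l t')) • X k l := by
    intro j t t'
    rw [heisenberg_expand hU.comm (hU.sum_mode j).symm,
      heisenberg_expand (hU.comm_star' hK) (hU.sum_star_mode hγ j).symm,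
      sum_smul_mul_sum_smul, Finset.smul_sum]
    refine Finset.sum_congr rfl fun k _ => ?_
    rw [Finset.smul_sum]
    refine Finset.sum_congr rfl fun l _ => ?_
    rw [smul_smul]
    congr 1
    have : Complex.exp (4 * Complex.I * ε k * (β * (t' - t) : ℝ)) *
        Complex.exp (4 * Complex.I * (-ε l : ℝ) * (-β * (t + t') : ℝ))
        = Complex.exp (4 * Complex.I * β * (ε l - ε k) * t) *
          Complex.exp ((4 * Complex.I * β * (ε k + ε l)) * t') := by
      rw [← Complex.exp_add, ← Complex.exp_add]
      congr 1
      push_cast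
      ring
    simp only [hP, hQ]
    linear_combination (b₂ t' * star (U j k) * U j l) * this
  have h2 : ∀ j (t : ℝ), b₁ t • ∫ t' : ℝ, b₂ t' •
      (heisenberg K (γ j) (β * (t' - t)) * heisenberg K (γ j) (-β * (t + t')))
      = ∑ k, ∑ l, (star (U j k) * U j l * ((∫ t', Q k l t') * (b₁ t * P k l t))) • X k l := by
    intro j t
    simp only [h1]
    rw [integral_modeSum U (fun k l => (hQi k l).const_mul (P k l t)), ← Complex.coe_smul]
    simp only [Finset.smul_sum, smul_smul, integral_const_mul]
    refine Finset.sum_congr rfl fun k _ => Finset.sum_congr rfl fun l _ => ?_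
    congr 1
    ring
  have hPi : ∀ k l, Integrable fun t : ℝ => (∫ t', Q k l t') * ((b₁ t : ℂ) * P k l t) := by
    intro k l
    refine Integrable.const_mul ?_ _
    have := integrable_b₁.ofReal (𝕜 := ℂ) |>.bdd_mul (f := P k l) (c := 1)
      (Continuous.aestronglyMeasurable (by fun_prop)) (ae_of_all _ fun t => ?_)
    · exact this.congr (ae_of_all _ fun t => mul_comm _ _)
    · have : 4 * Complex.I * β * (ε l - ε k) * t
          = ((4 * β * (ε l - ε k) * t : ℝ) : ℂ) * Complex.I := by push_cast; ring
      simp only [hP]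
      rw [this, Complex.norm_exp_ofReal_mul_I]
  have h3 : ∑ j, coherentTilde γ β K j = gibbsConj β K (∑ j, ∫ t : ℝ, b₁ t • ∫ t' : ℝ, b₂ t' •
      (heisenberg K (γ j) (β * (t' - t)) * heisenberg K (γ j) (-β * (t + t')))) := by
    simp only [coherentTilde, gibbsConj, Finset.mul_sum, Finset.sum_mul]
  rw [h3]
  simp only [h2]
  rw [hU.sum_integral_modeSum hPi]
  -- On the diagonal the phase in `t` is `1`, so what remains is the integral of the odd function
  -- `b₁`.
  have h4 : ∀ k, ∫ t : ℝ, (∫ t', Q k k t') * ((b₁ t : ℂ) * P k k t) = 0 := by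
    intro k
    rw [integral_const_mul]
    have : ∫ t : ℝ, (b₁ t : ℂ) * P k k t = ((∫ t, b₁ t : ℝ) : ℂ) := by
      rw [← integral_complex_ofReal]
      refine integral_congr_ae (ae_of_all _ fun t => ?_)
      simp [hP]
    rw [this, integral_b₁, Complex.ofReal_zero, mul_zero]
  simp [h4, gibbsConj]

theorem IsModeMatrix.parentC_eq_zero (hU : IsModeMatrix γ K U ε) (hγ : IsMajorana γ)
    (hK : IsSelfAdjoint K) (β : ℝ) : parentC γ β K = 0 := by
  have h := hU.sum_coherentTilde hγ hK β
  have h1 : ∑ j, leftMul (coherentTilde γ β K j) = 0 := by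
    simp only [leftMul, ← map_sum, h, map_zero]
  have h2 : ∑ j, rightMul (star (coherentTilde γ β K j)) = 0 := by
    simp only [rightMul, ← map_sum, ← star_sum, h, star_zero, map_zero]
  rw [parentC, Finset.sum_sub_distrib, h1, h2, sub_zero, ← PhiLin_apply, map_smul, map_zero,
    smul_zero]

/-- The dissipative part in normal modes. -/
theorem IsModeMatrix.parentD_eq (hU : IsModeMatrix γ K U ε) (hγ : IsMajorana γ)
    (hK : IsSelfAdjoint K) {β : ℝ} (hβ : 0 < β) :
    parentD γ β K = Phi γ (∑ k, (rate β (ε k) : ℂ) •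
      (leftMul (mode γ U k) * rightMul (star (mode γ U k))
        - (Real.exp (2 * β * ε k) / 2 : ℂ) •
          (leftMul (mode γ U k * star (mode γ U k))
            + rightMul (mode γ U k * star (mode γ U k))))) := by
  set X : Fin (2 * n) → Fin (2 * n) → SuperOp n := fun k l =>
    leftMul (mode γ U k) * rightMul (star (mode γ U l)) with hX
  set Y : Fin (2 * n) → Fin (2 * n) → SuperOp n := fun k l =>
    leftMul (mode γ U k * star (mode γ U l)) with hY
  set Z : Fin (2 * n) → Fin (2 * n) → SuperOp n := fun k l =>
    rightMul (mode γ U k * star (mode γ U l)) with hZ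
  set p : Fin (2 * n) → ℝ → ℝ := fun k ω => jumpFactor β (ε k) (-ω) with hp
  set q : Fin (2 * n) → ℝ → ℝ := fun k ω => jumpFactor β (-ε k) ω with hq
  have hpc : ∀ k, Continuous (p k) := fun k => (continuous_jumpFactor β _).comp continuous_neg
  have hqc : ∀ k, Continuous (q k) := fun k => continuous_jumpFactor β _
  have hpb : ∀ k ω, |p k ω| ≤ Real.exp (-(β * ε k)) * |filterHat β 0| :=
    fun k ω => abs_jumpFactor_le _ _ _
  have hqb : ∀ k ω, |q k ω| ≤ Real.exp (-(β * -ε k)) * |filterHat β 0| :=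
    fun k ω => abs_jumpFactor_le _ _ _
  set cX : Fin (2 * n) → Fin (2 * n) → ℝ → ℂ := fun k l ω =>
    ((eta β ω * (p k ω * p l ω) : ℝ) : ℂ) with hcX
  set cY : Fin (2 * n) → Fin (2 * n) → ℝ → ℂ := fun k l ω =>
    ((eta β ω * (p k ω * q l ω) : ℝ) : ℂ) with hcY
  set cZ : Fin (2 * n) → Fin (2 * n) → ℝ → ℂ := fun k l ω =>
    ((eta β ω * (q k ω * p l ω) : ℝ) : ℂ) with hcZ
  have hXi : ∀ k l, Integrable (cX k l) := fun k l =>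
    (integrable_eta_mul hβ (hpc k) (hpc l) (hpb k) (hpb l)).ofReal
  have hYi : ∀ k l, Integrable (cY k l) := fun k l =>
    (integrable_eta_mul hβ (hpc k) (hqc l) (hpb k) (hqb l)).ofReal
  have hZi : ∀ k l, Integrable (cZ k l) := fun k l =>
    (integrable_eta_mul hβ (hqc k) (hpc l) (hqb k) (hpb l)).ofReal
  -- The operator at `-ω` is expanded in modes and the one at `ω` in adjoint modes, so that all
  -- three terms of the generator carry the same coefficient `star (U j k) * U j l`.
  have hA1 : ∀ j ω, jumpTilde γ β K j (-ω) = ∑ k, (star (U j k) * p k ω : ℂ) • mode γ U k :=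
    fun j ω => jumpTilde_eq hβ hU.comm j (hU.sum_mode j).symm _
  have hA2 : ∀ j ω, jumpTilde γ β K j ω = ∑ l, (U j l * q l ω : ℂ) • star (mode γ U l) :=
    fun j ω => jumpTilde_eq hβ (hU.comm_star' hK) j (hU.sum_star_mode hγ j).symm _
  have hB1 : ∀ j ω, star (jumpTilde γ β K j (-ω))
      = ∑ l, (U j l * p l ω : ℂ) • star (mode γ U l) := by
    intro j ω
    rw [hA1, star_sum]
    simp [star_smul]
  have hB2 : ∀ j ω, star (jumpTilde γ β K j ω)
      = ∑ k, (star (U j k) * q k ω : ℂ) • mode γ U k := by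
    intro j ω
    rw [hA2, star_sum]
    simp [star_smul]
  have hint : ∀ j ω, eta β ω •
      (leftMul (jumpTilde γ β K j (-ω)) * rightMul (star (jumpTilde γ β K j (-ω)))
      - (1 / 2 : ℝ) • leftMul (jumpTilde γ β K j (-ω) * jumpTilde γ β K j ω)
      - (1 / 2 : ℝ) • rightMul (star (jumpTilde γ β K j ω) * star (jumpTilde γ β K j (-ω))))
      = (∑ k, ∑ l, (star (U j k) * U j l * cX k l ω) • X k l)
        - (1 / 2 : ℂ) • (∑ k, ∑ l, (star (U j k) * U j l * cY k l ω) • Y k l)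
        - (1 / 2 : ℂ) • (∑ k, ∑ l, (star (U j k) * U j l * cZ k l ω) • Z k l) := by
    intro j ω
    have hhalf : ∀ S : SuperOp n, (1 / 2 : ℝ) • S = (1 / 2 : ℂ) • S := by
      intro S
      rw [superOp_real_smul]
      norm_num
    have hlift : ∀ (p' q' : Fin (2 * n) → ℝ) (V : Fin (2 * n) → Fin (2 * n) → SuperOp n),
        (eta β ω : ℂ) • ∑ k, ∑ l, (star (U j k) * p' k * (U j l * q' l) : ℂ) • V k l
        = ∑ k, ∑ l, (star (U j k) * U j l * ((eta β ω * (p' k * q' l) : ℝ) : ℂ)) • V k l := by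
      intro p' q' V
      simp only [Finset.smul_sum, smul_smul]
      refine Finset.sum_congr rfl fun k _ => Finset.sum_congr rfl fun l _ => ?_
      congr 1
      push_cast
      ring
    have e1 : leftMul (jumpTilde γ β K j (-ω)) * rightMul (star (jumpTilde γ β K j (-ω)))
        = ∑ k, ∑ l, (star (U j k) * p k ω * (U j l * p l ω) : ℂ) • X k l := by
      rw [hB1, hA1, leftMul_sum_smul, rightMul_sum_smul]
      exact sum_smul_mul_sum_smul _ _ _ _
    have e2 : leftMul (jumpTilde γ β K j (-ω) * jumpTilde γ β K j ω)
        = ∑ k, ∑ l, (star (U j k) * p k ω * (U j l * q l ω) : ℂ) • Y k l := by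
      rw [hA1, hA2, sum_smul_mul_sum_smul]
      simp only [leftMul, map_sum, map_smul, hY]
    have e3 : rightMul (star (jumpTilde γ β K j ω) * star (jumpTilde γ β K j (-ω)))
        = ∑ k, ∑ l, (star (U j k) * q k ω * (U j l * p l ω) : ℂ) • Z k l := by
      rw [hB1, hB2, sum_smul_mul_sum_smul]
      simp only [rightMul, map_sum, map_smul, hZ]
    rw [e1, e2, e3, hhalf, hhalf, superOp_real_smul, smul_sub, smul_sub,
      smul_comm (eta β ω : ℂ) (1 / 2 : ℂ), smul_comm (eta β ω : ℂ) (1 / 2 : ℂ),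
      hlift (fun k => p k ω) (fun k => p k ω), hlift (fun k => p k ω) (fun k => q k ω),
      hlift (fun k => q k ω) (fun k => p k ω)]
  have hintegral : ∀ j, ∫ ω, ((∑ k, ∑ l, (star (U j k) * U j l * cX k l ω) • X k l)
        - (1 / 2 : ℂ) • (∑ k, ∑ l, (star (U j k) * U j l * cY k l ω) • Y k l)
        - (1 / 2 : ℂ) • (∑ k, ∑ l, (star (U j k) * U j l * cZ k l ω) • Z k l))
      = (∫ ω, ∑ k, ∑ l, (star (U j k) * U j l * cX k l ω) • X k l)
        - (1 / 2 : ℂ) • (∫ ω, ∑ k, ∑ l, (star (U j k) * U j l * cY k l ω) • Y k l)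
        - (1 / 2 : ℂ) • (∫ ω, ∑ k, ∑ l, (star (U j k) * U j l * cZ k l ω) • Z k l) := by
    intro j
    have i1 := integrable_modeSum U hXi X j
    have i2 : Integrable fun ω => (1 / 2 : ℂ) •
        (∑ k, ∑ l, (star (U j k) * U j l * cY k l ω) • Y k l) :=
      (integrable_modeSum U hYi Y j).smul (1 / 2 : ℂ)
    have i3 : Integrable fun ω => (1 / 2 : ℂ) •
        (∑ k, ∑ l, (star (U j k) * U j l * cZ k l ω) • Z k l) :=
      (integrable_modeSum U hZi Z j).smul (1 / 2 : ℂ)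
    have i12 : Integrable fun ω => (∑ k, ∑ l, (star (U j k) * U j l * cX k l ω) • X k l)
        - (1 / 2 : ℂ) • (∑ k, ∑ l, (star (U j k) * U j l * cY k l ω) • Y k l) := i1.sub i2
    rw [← integral_smul, ← integral_smul, ← integral_sub i1 i2, ← integral_sub i12 i3]
  rw [parentD]
  simp only [hint, hintegral]
  rw [Finset.sum_sub_distrib, Finset.sum_sub_distrib, ← Finset.smul_sum, ← Finset.smul_sum,
    hU.sum_integral_modeSum hXi, hU.sum_integral_modeSum hYi, hU.sum_integral_modeSum hZi,
    Finset.smul_sum, Finset.smul_sum, ← Finset.sum_sub_distrib, ← Finset.sum_sub_distrib]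
  congr 1
  refine Finset.sum_congr rfl fun k _ => ?_
  have v1 : ∫ ω, cX k k ω = (rate β (ε k) : ℂ) := by
    rw [← integral_eta_diag hβ, ← integral_complex_ofReal]
  have v2 : ∫ ω, cY k k ω = (rate β (ε k) * Real.exp (2 * β * ε k) : ℂ) := by
    rw [← Complex.ofReal_mul, ← integral_eta_mixed hβ, ← integral_complex_ofReal]
  have v3 : ∫ ω, cZ k k ω = (rate β (ε k) * Real.exp (2 * β * ε k) : ℂ) := by
    rw [← v2]
    simp only [hcY, hcZ, mul_comm]
  rw [v1, v2, v3]
  simp only [hX, hY, hZ]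
  module

end Parent

/-! ### Diagonalization of the free parent Hamiltonian -/

section Diagonalization

variable {n : ℕ} {γ : Fin (2 * n) → Op n} {K : Op n}
  {U : Matrix (Fin (2 * n)) (Fin (2 * n)) ℂ} {ε : Fin (2 * n) → ℝ}

/-- An operator is odd when it anti-commutes with the chirality. -/
def IsOddOp (γ : Fin (2 * n) → Op n) (W : Op n) : Prop :=
  chirality γ * W = -(W * chirality γ)

theorem IsMajorana.isOddOp_combination (hγ : IsMajorana γ) (v : Fin (2 * n) → ℂ) :
    IsOddOp γ (combination γ v) := by
  simp only [IsOddOp, combination, Finset.mul_sum, Finset.sum_mul, mul_smul_comm, smul_mul_assoc,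
    hγ.chirality_mul, smul_neg, Finset.sum_neg_distrib]

theorem IsMajorana.isOddOp_mode (hγ : IsMajorana γ) (k : Fin (2 * n)) :
    IsOddOp γ (mode γ U k) := hγ.isOddOp_combination _

theorem IsMajorana.isOddOp_star_mode (hγ : IsMajorana γ) (k : Fin (2 * n)) :
    IsOddOp γ (star (mode γ U k)) := by
  rw [mode, hγ.star_combination]
  exact hγ.isOddOp_combination _

/-- Third-quantized left multiplication. -/
def leftOp (γ : Fin (2 * n) → Op n) (W : Op n) : Op' n := rep γ (leftMul W)

/-- Third-quantized right multiplication by an odd operator. -/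
def rightOp (γ : Fin (2 * n) → Op n) (W : Op n) : Op' n := rep γ (rightMul W) * parity' n

variable {W V : Op n}

theorem leftOp_mul (hγ : IsMajorana γ) (W V : Op n) :
    leftOp γ W * leftOp γ V = leftOp γ (W * V) := by
  rw [leftOp, leftOp, leftOp, leftMul_mul, rep_mul hγ]

/-- The order reverses as for any right multiplication; the sign comes from moving one parity
operator past an odd operator. -/
theorem rightOp_mul (hγ : IsMajorana γ) (hV : IsOddOp γ V) :
    rightOp γ W * rightOp γ V = -rep γ (rightMul (V * W)) := by
  rw [rightOp, rightOp, mul_assoc, ← mul_assoc (parity' n), parity'_mul_rightMul hγ hV, neg_mul,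
    mul_assoc, parity'_mul_self, mul_one, mul_neg, rightMul_mul, rep_mul hγ]

/-- Plain left and right multiplications commute, and the parity factor in `rightOp` turns this into
anticommutation. This is what the twist in `Φ` is for. -/
theorem rightOp_mul_leftOp (hγ : IsMajorana γ) (hW : IsOddOp γ W) :
    rightOp γ V * leftOp γ W = -(leftOp γ W * rightOp γ V) := by
  rw [rightOp, leftOp, mul_assoc, parity'_mul_leftMul hγ hW, mul_neg, ← mul_assoc, ← mul_assoc,
    ← rep_mul hγ, ← rep_mul hγ, leftMul_comm_rightMul]

theorem star_leftOp (hγ : IsMajorana γ) (W : Op n) : star (leftOp γ W) = leftOp γ (star W) :=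
  star_rep_leftMul hγ W

theorem star_rightOp (hγ : IsMajorana γ) (hW : IsOddOp γ (star W)) :
    star (rightOp γ W) = -rightOp γ (star W) := by
  rw [rightOp, star_mul, star_parity', star_rep_rightMul hγ, parity'_mul_rightMul hγ hW, rightOp]

theorem leftOp_smul_one (hγ : IsMajorana γ) (s : ℂ) : leftOp γ (s • 1) = s • 1 := by
  rw [leftOp, leftMul, map_smul, rep_smul]
  exact congrArg (s • ·) ((congrArg (rep γ) leftMul_one).trans (rep_one hγ))

theorem rep_rightMul_smul_one (hγ : IsMajorana γ) (s : ℂ) :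
    rep γ (rightMul (s • 1)) = s • 1 := by
  rw [rightMul, map_smul, rep_smul]
  exact congrArg (s • ·) ((congrArg (rep γ) rightMul_one).trans (rep_one hγ))

theorem leftOp_add (W V : Op n) : leftOp γ (W + V) = leftOp γ W + leftOp γ V := by
  rw [leftOp, leftMul, map_add, rep_add]; rfl

theorem rep_rightMul_add (W V : Op n) :
    rep γ (rightMul (W + V)) = rep γ (rightMul W) + rep γ (rightMul V) := by
  rw [rightMul, map_add, rep_add]; rfl

/-- Anti-commutator of third-quantized modes. -/
theorem mixed_anticomm (hγ : IsMajorana γ) (hW : IsOddOp γ W) (hV : IsOddOp γ V) {s : ℂ}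
    (hs : W * V + V * W = s • 1) (a b a' b' : ℂ) :
    (a • leftOp γ W + b • rightOp γ W) * (a' • leftOp γ V + b' • rightOp γ V)
      + (a' • leftOp γ V + b' • rightOp γ V) * (a • leftOp γ W + b • rightOp γ W)
      = ((a * a' - b * b') * s) • 1 := by
  have h1 : leftOp γ W * leftOp γ V + leftOp γ V * leftOp γ W = s • 1 := by
    rw [leftOp_mul hγ, leftOp_mul hγ, ← leftOp_add, hs, leftOp_smul_one hγ]
  have h2 : rightOp γ W * rightOp γ V + rightOp γ V * rightOp γ W = -(s • 1) := by
    rw [rightOp_mul hγ hV, rightOp_mul hγ hW, ← neg_add, ← rep_rightMul_add, add_comm, hs,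
      rep_rightMul_smul_one hγ]
  have h3 := rightOp_mul_leftOp (V := W) hγ hV
  have h4 := rightOp_mul_leftOp (V := V) hγ hW
  have h1' := eq_sub_of_add_eq h1
  have h2' := eq_sub_of_add_eq h2
  simp only [mul_add, add_mul, smul_mul_smul_comm, h3, h4, h1', h2']
  module

/-- The annihilation operators that diagonalize the free parent Hamiltonian. -/
def annihilator (γ : Fin (2 * n) → Op n) (U : Matrix (Fin (2 * n)) (Fin (2 * n)) ℂ)
    (ε : Fin (2 * n) → ℝ) (β : ℝ) (k : Fin (2 * n)) : Op' n :=
  ((1 / (2 * √(Real.cosh (2 * β * ε k))) * Real.exp (β * ε k) : ℝ) : ℂ) •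
      leftOp γ (star (mode γ U k))
    + ((-(1 / (2 * √(Real.cosh (2 * β * ε k))) * Real.exp (-(β * ε k))) : ℝ) : ℂ) •
      rightOp γ (star (mode γ U k))

theorem IsMajorana.star_annihilator (hγ : IsMajorana γ) (β : ℝ) (k : Fin (2 * n)) :
    star (annihilator γ U ε β k)
      = ((1 / (2 * √(Real.cosh (2 * β * ε k))) * Real.exp (β * ε k) : ℝ) : ℂ) •
          leftOp γ (mode γ U k)
        + ((1 / (2 * √(Real.cosh (2 * β * ε k))) * Real.exp (-(β * ε k)) : ℝ) : ℂ) •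
          rightOp γ (mode γ U k) := by
  rw [annihilator, star_add, star_smul, star_smul, star_leftOp hγ, star_rightOp hγ, star_star]
  · simp only [RCLike.star_def, Complex.conj_ofReal, smul_neg]
    rw [← neg_smul, ← Complex.ofReal_neg, neg_neg]
  · rw [star_star]; exact hγ.isOddOp_mode k

theorem sq_normalization (x : ℝ) :
    (1 / (2 * √(Real.cosh x))) * (1 / (2 * √(Real.cosh x))) = 1 / (4 * Real.cosh x) := by
  have : √(Real.cosh x) * √(Real.cosh x) = Real.cosh x := Real.mul_self_sqrt (Real.cosh_pos x).le
  rw [div_mul_div_comm, mul_mul_mul_comm, this]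
  norm_num

/-- In `mixed_anticomm` the right multiplications enter with a minus sign. For two annihilators of
opposite energies the products of exponentials are both `1` and cancel. For an annihilator and its
own adjoint they add up to `2 cosh(2βε_k)`, which the normalization and the `2` of the mode relation
turn into `1`. -/
theorem IsModeMatrix.isCAR (hU : IsModeMatrix γ K U ε) (hγ : IsMajorana γ) (β : ℝ) :
    IsCAR (annihilator γ U ε β) where
  anticomm k l := by
    have hs : star (mode γ U k) * star (mode γ U l) + star (mode γ U l) * star (mode γ U k)
        = star (2 * overlap U k l) • (1 : Op n) := by
      have := congrArg star (hγ.mode_anticomm (U := U) k l)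
      rw [star_add, star_mul, star_mul, star_smul, star_one, add_comm] at this
      exact this
    rw [annihilator, annihilator,
      mixed_anticomm hγ (hγ.isOddOp_star_mode k) (hγ.isOddOp_star_mode l) hs]
    -- Either the energies are opposite and the coefficients cancel, or the overlap of the modes
    -- vanishes.
    by_cases h : ε k + ε l = 0
    · have h' : ε k = -ε l := by linarith
      rw [← Complex.ofReal_mul, ← Complex.ofReal_mul, ← Complex.ofReal_sub, h']
      simp only [mul_neg, Real.cosh_neg, neg_neg]
      have : 1 / (2 * √(Real.cosh (2 * β * ε l))) * Real.exp (-(β * ε l)) *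
          (1 / (2 * √(Real.cosh (2 * β * ε l))) * Real.exp (β * ε l)) -
          -(1 / (2 * √(Real.cosh (2 * β * ε l))) * Real.exp (β * ε l)) *
          -(1 / (2 * √(Real.cosh (2 * β * ε l))) * Real.exp (-(β * ε l))) = 0 := by ring
      simp only [neg_mul, mul_neg, neg_neg] at this ⊢
      rw [this, Complex.ofReal_zero, zero_mul, zero_smul]
    · rw [hU.overlap_eq_zero hγ h]; simp
  anticomm_star k l := by
    have hs : star (mode γ U k) * mode γ U l + mode γ U l * star (mode γ U k)
        = (if k = l then (2 : ℂ) else 0) • (1 : Op n) := by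
      rw [add_comm, hU.mode_anticomm_star hγ]
      simp only [eq_comm]
    rw [hγ.star_annihilator, annihilator,
      mixed_anticomm hγ (hγ.isOddOp_star_mode k) (hγ.isOddOp_mode l) hs]
    split_ifs with h
    · subst h
      rw [← Complex.ofReal_mul, ← Complex.ofReal_mul, ← Complex.ofReal_sub]
      have h1 := sq_normalization (2 * β * ε k)
      have h2 : Real.exp (β * ε k) * Real.exp (β * ε k)
          + Real.exp (-(β * ε k)) * Real.exp (-(β * ε k)) = 2 * Real.cosh (2 * β * ε k) := by
        rw [← Real.exp_add, ← Real.exp_add, Real.cosh_eq]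
        ring_nf
      have h3 := (Real.cosh_pos (2 * β * ε k)).ne'
      have : ∀ x : ℝ, x * Real.exp (β * ε k) * (x * Real.exp (β * ε k))
          - -(x * Real.exp (-(β * ε k))) * (x * Real.exp (-(β * ε k)))
          = x * x * (Real.exp (β * ε k) * Real.exp (β * ε k)
            + Real.exp (-(β * ε k)) * Real.exp (-(β * ε k))) := fun x => by ring
      rw [this, h1, h2, show 1 / (4 * Real.cosh (2 * β * ε k)) * (2 * Real.cosh (2 * β * ε k))
        = 1 / 2 by field_simp; norm_num]
      norm_num
    · simp

/-- The single-mode energies of the parent Hamiltonian. -/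
def modeGap (β ε : ℝ) : ℝ := 2 * rate β ε * Real.cosh (2 * β * ε)

theorem modeGap_pos (β ε : ℝ) : 0 < modeGap β ε := by
  have := rate_pos β ε
  have := Real.cosh_pos (2 * β * ε)
  unfold modeGap
  positivity

/-- The hyperbolic cosine in `modeGap` cancels the normalization of the annihilators, so the
coefficients become those of the dissipator. The last two terms still have `b_k` and its adjoint
exchanged; this is repaired only after summing over `k`. -/
theorem IsMajorana.modeGap_smul (hγ : IsMajorana γ) (β : ℝ) (k : Fin (2 * n)) :
    (modeGap β (ε k) : ℂ) • (star (annihilator γ U ε β k) * annihilator γ U ε β k)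
      = ((rate β (ε k) : ℂ) / 2) • ((Real.exp (2 * β * ε k) : ℂ) •
          leftOp γ (mode γ U k * star (mode γ U k))
        - leftOp γ (mode γ U k) * rightOp γ (star (mode γ U k))
        - leftOp γ (star (mode γ U k)) * rightOp γ (mode γ U k)
        + (Real.exp (2 * β * -ε k) : ℂ) • rep γ (rightMul (star (mode γ U k) * mode γ U k))) := by
  have h1 : (modeGap β (ε k)) *
      ((1 / (2 * √(Real.cosh (2 * β * ε k)))) * (1 / (2 * √(Real.cosh (2 * β * ε k)))))
      = rate β (ε k) / 2 := by
    have h3 := (Real.cosh_pos (2 * β * ε k)).ne'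
    rw [sq_normalization, modeGap]
    field_simp
    ring
  set x := 1 / (2 * √(Real.cosh (2 * β * ε k))) with hx
  set p := Real.exp (β * ε k) with hp
  set q := Real.exp (-(β * ε k)) with hq
  have hpp : Real.exp (2 * β * ε k) = p * p := by
    rw [hp, ← Real.exp_add]; congr 1; ring
  have hqq : Real.exp (2 * β * -ε k) = q * q := by
    rw [hq, ← Real.exp_add]; congr 1; ring
  have hpq : p * q = 1 := by rw [hp, hq, ← Real.exp_add]; simp
  have h1c : (modeGap β (ε k) : ℂ) * ((x : ℂ) * x) = (rate β (ε k) : ℂ) / 2 := by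
    exact_mod_cast congrArg (fun r : ℝ => (r : ℂ)) h1
  have hpqc : (p : ℂ) * q = 1 := by exact_mod_cast hpq
  rw [hγ.star_annihilator, annihilator, ← hx, ← hp, ← hq, ← h1c, hpp, hqq]
  simp only [mul_add, add_mul, smul_mul_smul_comm]
  rw [leftOp_mul hγ, rightOp_mul hγ (hγ.isOddOp_star_mode k),
    rightOp_mul_leftOp hγ (hγ.isOddOp_star_mode k)]
  set A := leftOp γ (mode γ U k * star (mode γ U k))
  set B := leftOp γ (mode γ U k) * rightOp γ (star (mode γ U k))
  set C := leftOp γ (star (mode γ U k)) * rightOp γ (mode γ U k)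
  set D := rep γ (rightMul (star (mode γ U k) * mode γ U k))
  -- The factor `p * q = 1` is inserted so that both sides agree as linear combinations with
  -- polynomial coefficients.
  have hB : (modeGap β (ε k) * (x * x) : ℂ) • B
      = (modeGap β (ε k) * (x * x) * (p * q) : ℂ) • B := by rw [hpqc, mul_one]
  have hC : (modeGap β (ε k) * (x * x) : ℂ) • C
      = (modeGap β (ε k) * (x * x) * (p * q) : ℂ) • C := by rw [hpqc, mul_one]
  have hdist : ∀ s r t : ℂ, s • (r • A - B - C + t • D)
      = s • r • A - s • B - s • C + s • t • D := fun s r t => by module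
  rw [hdist, hB, hC]
  push_cast
  module

/-- The bilinear map `(W, V) ↦ Φ(L_W R_V)` for odd `V`. -/
def leftRightBilin (γ : Fin (2 * n) → Op n) : Op n →ₗ[ℂ] Op n →ₗ[ℂ] Op' n :=
  LinearMap.mk₂ ℂ (fun W V => leftOp γ W * rightOp γ V)
    (fun W W' V => by rw [leftOp_add, add_mul])
    (fun a W V => by simp only [leftOp, leftMul, map_smul, rep_smul, smul_mul_assoc])
    (fun W V V' => by rw [rightOp, rep_rightMul_add, add_mul, mul_add]; rfl)
    (fun a W V => by
      simp only [rightOp, rightMul, map_smul, rep_smul, smul_mul_assoc, mul_smul_comm])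

/-- The bilinear map `(W, V) ↦ Φ(R_{W V})` for even `W V`. -/
def rightMulBilin (γ : Fin (2 * n) → Op n) : Op n →ₗ[ℂ] Op n →ₗ[ℂ] Op' n :=
  LinearMap.mk₂ ℂ (fun W V => rep γ (rightMul (W * V)))
    (fun W W' V => by rw [add_mul, rep_rightMul_add])
    (fun a W V => by simp only [smul_mul_assoc, rightMul, map_smul, rep_smul])
    (fun W V V' => by rw [mul_add, rep_rightMul_add])
    (fun a W V => by simp only [mul_smul_comm, rightMul, map_smul, rep_smul])

/-- Mode by mode the two sides differ; they agree after summation, because conjugation permits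
exchanging `b_k` with its adjoint together with `ε_k ↦ -ε_k`. The identities `hs1` and `hs2` perform
this exchange on the mixed terms and on the right multiplications. -/
theorem IsModeMatrix.parentHamiltonian_eq (hU : IsModeMatrix γ K U ε) (hγ : IsMajorana γ)
    (hK : IsSelfAdjoint K) {β : ℝ} (hβ : 0 < β) :
    parentHamiltonian γ β K
      = carHamiltonian (annihilator γ U ε β) fun k => modeGap β (ε k) := by
  have hs1 : ∑ k, (rate β (-ε k) : ℂ) • (leftOp γ (star (mode γ U k)) * rightOp γ (mode γ U k))
      = ∑ k, (rate β (ε k) : ℂ) • (leftOp γ (mode γ U k) * rightOp γ (star (mode γ U k))) :=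
    hU.sum_swap hγ (leftRightBilin γ) fun e => (rate β e : ℂ)
  have hs2 : ∑ k, (rate β (-ε k) * Real.exp (2 * β * -ε k) : ℂ) •
        rep γ (rightMul (star (mode γ U k) * mode γ U k))
      = ∑ k, (rate β (ε k) * Real.exp (2 * β * ε k) : ℂ) •
        rep γ (rightMul (mode γ U k * star (mode γ U k))) :=
    hU.sum_swap hγ (rightMulBilin γ) fun e => (rate β e : ℂ) * (Real.exp (2 * β * e) : ℂ)
  simp only [rate_neg] at hs1 hs2
  have hcomm : ∀ k, chirality γ * (mode γ U k * star (mode γ U k))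
      = mode γ U k * star (mode γ U k) * chirality γ := by
    intro k
    have h1 : chirality γ * _ = _ := hγ.isOddOp_mode (U := U) k
    have h2 : chirality γ * _ = _ := hγ.isOddOp_star_mode (U := U) k
    rw [← mul_assoc, h1, neg_mul, mul_assoc, h2, mul_neg, neg_neg, mul_assoc]
  rw [parentHamiltonian, hU.parentC_eq_zero hγ hK, zero_add, hU.parentD_eq hγ hK hβ,
    ← PhiLin_apply]
  simp only [map_sum, map_smul, map_sub, map_add]
  simp only [PhiLin_apply, Phi_leftMul_rightMul, Phi_leftMul hγ, Phi_rightMul hγ,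
    PhiRight_of_commute hγ (hcomm _), PhiRight_of_anticommute hγ (hγ.isOddOp_star_mode _)]
  change ∑ k, (rate β (ε k) : ℂ) • (leftOp γ (mode γ U k) * rightOp γ (star (mode γ U k))
    - (Real.exp (2 * β * ε k) / 2 : ℂ) • (leftOp γ (mode γ U k * star (mode γ U k))
      + rep γ (rightMul (mode γ U k * star (mode γ U k))))) = _
  rw [carHamiltonian]
  simp only [hγ.modeGap_smul]
  have e1 : ∀ k, (rate β (ε k) : ℂ) • (leftOp γ (mode γ U k) * rightOp γ (star (mode γ U k))
      - (Real.exp (2 * β * ε k) / 2 : ℂ) • (leftOp γ (mode γ U k * star (mode γ U k))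
        + rep γ (rightMul (mode γ U k * star (mode γ U k)))))
      = (rate β (ε k) : ℂ) • (leftOp γ (mode γ U k) * rightOp γ (star (mode γ U k)))
        - (1 / 2 : ℂ) • (rate β (ε k) * Real.exp (2 * β * ε k) : ℂ) •
          leftOp γ (mode γ U k * star (mode γ U k))
        - (1 / 2 : ℂ) • (rate β (ε k) * Real.exp (2 * β * ε k) : ℂ) •
          rep γ (rightMul (mode γ U k * star (mode γ U k))) := fun k => by module
  have e2 : ∀ k, ((rate β (ε k) : ℂ) / 2) • ((Real.exp (2 * β * ε k) : ℂ) •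
          leftOp γ (mode γ U k * star (mode γ U k))
        - leftOp γ (mode γ U k) * rightOp γ (star (mode γ U k))
        - leftOp γ (star (mode γ U k)) * rightOp γ (mode γ U k)
        + (Real.exp (2 * β * -ε k) : ℂ) • rep γ (rightMul (star (mode γ U k) * mode γ U k)))
      = (1 / 2 : ℂ) • (rate β (ε k) * Real.exp (2 * β * ε k) : ℂ) •
          leftOp γ (mode γ U k * star (mode γ U k))
        - (1 / 2 : ℂ) • (rate β (ε k) : ℂ) •
          (leftOp γ (mode γ U k) * rightOp γ (star (mode γ U k)))
        - (1 / 2 : ℂ) • (rate β (ε k) : ℂ) •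
          (leftOp γ (star (mode γ U k)) * rightOp γ (mode γ U k))
        + (1 / 2 : ℂ) • (rate β (ε k) * Real.exp (2 * β * -ε k) : ℂ) •
          rep γ (rightMul (star (mode γ U k) * mode γ U k)) := fun k => by module
  simp only [e1, e2, Finset.sum_sub_distrib, Finset.sum_add_distrib, ← Finset.smul_sum, hs1, hs2]
  module

end Diagonalization

/-! ### Locality bounds the single-particle energies -/

section Locality

variable {n D : ℕ} {γ : Fin (2 * n) → Op n} {h : Matrix (Fin (2 * n)) (Fin (2 * n)) ℂ}

/-- A bound on the number of lattice points in a ball of radius `r`. -/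
def ballBound (D : ℕ) (r : ℝ) : ℕ :=
  (Fintype.piFinset fun _ : Fin D => Finset.Icc (-⌊r⌋) ⌊r⌋).card

theorem latticeDist_comm (x y : Fin D → ℤ) : latticeDist x y = latticeDist y x := by
  unfold latticeDist
  congr 1
  exact Finset.sum_congr rfl fun i _ => by ring

open Classical in
-- Coordinate differences are integers of absolute value at most `r`, so distinct sites give
-- distinct points of a cube of half-width `⌊r⌋`.
theorem card_ball_le {site : Fin n → Fin D → ℤ} (hsite : Function.Injective site) (r : ℝ)
    (x : Fin D → ℤ) :
    (Finset.univ.filter fun b => latticeDist x (site b) ≤ r).card ≤ ballBound D r := by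
  refine Finset.card_le_card_of_injOn (fun b i => x i - site b i) (fun b hb => ?_)
    (fun b _ b' _ e => hsite ?_)
  · have hb' : latticeDist x (site b) ≤ r := (Finset.mem_filter.1 hb).2
    refine Finset.mem_coe.2 (Fintype.mem_piFinset.2 fun i => Finset.mem_Icc.2 ?_)
    have h1 : |((x i - site b i : ℤ) : ℝ)| ≤ r := by
      refine le_trans ?_ hb'
      rw [latticeDist, ← Real.sqrt_sq_eq_abs]
      refine Real.sqrt_le_sqrt ?_
      push_cast
      exact Finset.single_le_sum (f := fun i => ((x i : ℝ) - (site b i : ℝ)) ^ 2)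
        (fun i _ => sq_nonneg _) (Finset.mem_univ i)
    have h2 : |x i - site b i| ≤ ⌊r⌋ := by
      rw [Int.le_floor]
      push_cast at h1 ⊢
      exact h1
    exact abs_le.1 h2
  · ext i
    have := congrFun e i
    simp only at this
    omega

open Classical in
theorem card_modes_le (S : Set (Fin n)) :
    (Finset.univ.filter fun j : Fin (2 * n) => siteIndex j ∈ S).card
      ≤ 2 * (Finset.univ.filter fun b => b ∈ S).card := by
  have h1 := Finset.card_le_card_of_injOn (s := Finset.univ.filter fun j : Fin (2 * n) =>
      siteIndex j ∈ S) (t := (Finset.univ : Finset (Fin 2)) ×ˢ Finset.univ.filter fun b => b ∈ S)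
    (fun j => (⟨(j : ℕ) % 2, Nat.mod_lt _ two_pos⟩, siteIndex j))
    (fun j hj => by
      have := (Finset.mem_filter.1 hj).2
      simpa using this)
    (fun j _ j' _ e => by
      have e1 := congrArg (fun p => (p.1 : ℕ)) e
      have e2 := congrArg (fun p => (p.2 : ℕ)) e
      simp only [siteIndex] at e1 e2
      ext
      omega)
  rwa [Finset.card_product, Finset.card_univ, Fintype.card_fin] at h1

theorem norm_trace_le (X : Op n) : ‖LinearMap.trace ℂ (Fock n) (X : Op n)‖ ≤ 2 ^ n * ‖X‖ := by
  rw [LinearMap.trace_eq_sum_inner _ (stdBasis n)]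
  refine (norm_sum_le _ _).trans ?_
  have h1 : ∀ i, ‖inner ℂ (stdBasis n i) ((X : Fock n →ₗ[ℂ] Fock n) (stdBasis n i))‖ ≤ ‖X‖ := by
    intro i
    refine (norm_inner_le_norm _ _).trans ?_
    have := X.le_opNorm (stdBasis n i)
    rw [(stdBasis n).norm_eq_one, mul_one] at this
    rw [(stdBasis n).norm_eq_one, one_mul]
    exact this
  refine (Finset.sum_le_sum fun i _ => h1 i).trans ?_
  rw [Finset.sum_const, Finset.card_univ]
  simp

theorem trace_op_one : LinearMap.trace ℂ (Fock n) ((1 : Op n) : Fock n →ₗ[ℂ] Fock n) = 2 ^ n := by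
  have h1 : LinearMap.trace ℂ (Fock n) ((1 : Op n) : Fock n →ₗ[ℂ] Fock n)
    = Module.finrank ℂ (Fock n) := LinearMap.trace_one _ _
  rw [h1, finrank_fock]
  norm_num

/-- The trace as a linear functional on operators. -/
def opTrace (n : ℕ) : Op n →ₗ[ℂ] ℂ :=
  LinearMap.trace ℂ (Fock n) ∘ₗ ContinuousLinearMap.coeLM ℂ

theorem opTrace_mul_comm (X Y : Op n) : opTrace n (X * Y) = opTrace n (Y * X) :=
  trace_op_mul_comm X Y

theorem opTrace_one : opTrace n 1 = 2 ^ n := trace_op_one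

theorem norm_opTrace_le (X : Op n) : ‖opTrace n X‖ ≤ 2 ^ n * ‖X‖ := norm_trace_le X

theorem opTrace_eq_zero_of_anticommute {Q X : Op n} (hQ : Q * star Q = 1) (hQ' : star Q * Q = 1)
    (hX : Q * X = -(X * Q)) : opTrace n X = 0 := by
  have h1 : opTrace n X = opTrace n (Q * X * star Q) := by
    rw [opTrace_mul_comm, ← mul_assoc, hQ', one_mul]
  rw [hX, neg_mul, mul_assoc, hQ, mul_one, map_neg] at h1
  exact self_eq_neg.1 h1

/-- The product of the chirality with `γ j` commutes with every other Majorana operator and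
anticommutes with `γ j`. It therefore commutes with `w`, anticommutes with `w γ_j γ_k`, and being
unitary forces the trace of the latter to vanish. -/
theorem IsMajorana.opTrace_supportedOn (hγ : IsMajorana γ) {S : Set (Fin n)} {w : Op n}
    (hw : SupportedOn γ S w) {j k : Fin (2 * n)} (hj : siteIndex j ∉ S) (hjk : j ≠ k) :
    opTrace n (w * (γ j * γ k)) = 0 := by
  set Q := chirality γ * γ j with hQ
  have hcomm : ∀ i, i ≠ j → Q * γ i = γ i * Q := by
    intro i hi
    have h1 := hγ.anticomm j i
    rw [if_neg (Ne.symm hi)] at h1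
    rw [hQ, mul_assoc, eq_neg_of_add_eq_zero_left h1, mul_neg, ← mul_assoc, hγ.chirality_mul,
      neg_mul, neg_neg, mul_assoc]
  have hanti : Q * γ j = -(γ j * Q) := by
    rw [hQ, ← mul_assoc (γ j), ← neg_mul, ← hγ.chirality_mul]
  have hQw : Q * w = w * Q := by
    have hle : Algebra.adjoin ℂ (γ '' {i | siteIndex i ∈ S}) ≤ Subalgebra.centralizer ℂ {Q} := by
      refine Algebra.adjoin_le ?_
      rintro _ ⟨i, hi, rfl⟩
      rw [SetLike.mem_coe, Subalgebra.mem_centralizer_iff]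
      rintro _ rfl
      exact hcomm i fun e => hj (e ▸ hi)
    exact (Subalgebra.mem_centralizer_iff ℂ).1 (hle hw) Q rfl
  refine opTrace_eq_zero_of_anticommute (Q := Q) ?_ ?_ ?_
  · rw [hQ, star_mul, hγ.selfAdjoint, mul_assoc, ← mul_assoc (γ j), hγ.sq, one_mul,
      hγ.chirality_mul_star]
  · rw [hQ, star_mul, hγ.selfAdjoint, mul_assoc, ← mul_assoc (star _), hγ.star_chirality_mul,
      one_mul, hγ.sq]
  · rw [← mul_assoc, hQw, mul_assoc w, ← mul_assoc Q, hanti, neg_mul, mul_assoc (γ j),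
      hcomm k (Ne.symm hjk)]
    simp only [mul_neg, mul_assoc]

theorem IsMajorana.opTrace_mul (hγ : IsMajorana γ) (i k : Fin (2 * n)) :
    opTrace n (γ i * γ k) = if i = k then 2 ^ n else 0 := by
  have h1 := congrArg (opTrace n) (hγ.anticomm_smul i k)
  rw [map_add, opTrace_mul_comm (γ k), map_smul, opTrace_one, smul_eq_mul] at h1
  split_ifs with h
  · rw [if_pos h] at h1
    linear_combination h1 / 2
  · rw [if_neg h] at h1
    linear_combination h1 / 2

/-- Multiply the formula for `[K, γ_j]` by `γ k` and take traces: by cyclicity and anticommutation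
the two terms of the commutator contribute equally. -/
theorem IsMajorana.opTrace_quadratic (hγ : IsMajorana γ) {j k : Fin (2 * n)} (hjk : j ≠ k) :
    opTrace n (quadratic γ h * (γ j * γ k)) = 2 * 2 ^ n * antisymmPart h k j := by
  have h1 := congrArg (fun X => opTrace n (X * γ k)) (hγ.quadratic_mul (h := h) j)
  simp only [add_mul, map_add, Finset.sum_mul, map_sum, smul_mul_assoc, map_smul,
    hγ.opTrace_mul, smul_eq_mul, mul_ite, mul_zero, Finset.sum_ite_eq', Finset.mem_univ,
    if_true] at h1
  have h2 : opTrace n (γ j * quadratic γ h * γ k)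
      = -opTrace n (quadratic γ h * (γ j * γ k)) := by
    have h3 := hγ.anticomm k j
    rw [if_neg (Ne.symm hjk)] at h3
    rw [mul_assoc, opTrace_mul_comm, mul_assoc, eq_neg_of_add_eq_zero_left h3, mul_neg, map_neg]
  rw [h2, mul_assoc] at h1
  linear_combination h1 / 2

theorem IsMajorana.norm_le_one (hγ : IsMajorana γ) (j : Fin (2 * n)) : ‖γ j‖ ≤ 1 := by
  have hu : γ j ∈ unitary (Op n) := by
    rw [Unitary.mem_iff, hγ.selfAdjoint]
    exact ⟨hγ.sq j, hγ.sq j⟩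
  exact (CStarRing.norm_of_mem_unitary hu).le

open Classical in
-- The entry is a normalized trace of `K γ_j γ_k`, and a local term contributes only if its ball
-- contains the sites of both modes. Each such term contributes at most `1/2`, because `w a`, `γ j`
-- and `γ k` have norm at most `1`.
theorem IsMajorana.norm_antisymmPart_le (hγ : IsMajorana γ) {site : Fin n → Fin D → ℤ} {r : ℝ}
    (hloc : GeometricallyLocal γ site 1 r (quadratic γ h)) (k j : Fin (2 * n)) :
    ‖antisymmPart h k j‖ ≤ ∑ a, (if latticeDist (site a) (site (siteIndex k)) ≤ r then
      (if latticeDist (site a) (site (siteIndex j)) ≤ r then (1 / 2 : ℝ) else 0) else 0) := by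
  have hnonneg : 0 ≤ ∑ a, (if latticeDist (site a) (site (siteIndex k)) ≤ r then
      (if latticeDist (site a) (site (siteIndex j)) ≤ r then (1 / 2 : ℝ) else 0) else 0) :=
    Finset.sum_nonneg fun a _ => by split_ifs <;> norm_num
  by_cases hjk : j = k
  · subst hjk
    rw [antisymmPart_apply, sub_self, mul_zero, norm_zero]
    exact hnonneg
  obtain ⟨w, hw, hwa⟩ := hloc
  have h1 := hγ.opTrace_quadratic (h := h) hjk
  rw [hw, Finset.sum_mul, map_sum] at h1
  have h2 : ‖(2 * 2 ^ n * antisymmPart h k j : ℂ)‖ = 2 * 2 ^ n * ‖antisymmPart h k j‖ := by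
    simp
  have h3 : ∀ a, ‖opTrace n (w a * (γ j * γ k))‖
      ≤ 2 * 2 ^ n * (if latticeDist (site a) (site (siteIndex k)) ≤ r then
      (if latticeDist (site a) (site (siteIndex j)) ≤ r then (1 / 2 : ℝ) else 0) else 0) := by
    intro a
    obtain ⟨hs, hn⟩ := hwa a
    split_ifs with hk hj
    · refine (norm_opTrace_le _).trans ?_
      have : ‖w a * (γ j * γ k)‖ ≤ 1 * (1 * 1) :=
        (norm_mul_le _ _).trans (mul_le_mul hn ((norm_mul_le _ _).trans
          (mul_le_mul (hγ.norm_le_one j) (hγ.norm_le_one k) (norm_nonneg _) zero_le_one))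
          (norm_nonneg _) zero_le_one)
      have hp : (0 : ℝ) < 2 ^ n := by positivity
      nlinarith
    · rw [hγ.opTrace_supportedOn hs hj hjk]; simp
    · have h4 := hγ.anticomm j k
      rw [if_neg hjk] at h4
      rw [eq_neg_of_add_eq_zero_left h4, mul_neg, map_neg,
        hγ.opTrace_supportedOn hs hk (Ne.symm hjk)]
      simp
  have h4 := (norm_sum_le _ _).trans (Finset.sum_le_sum fun a (_ : a ∈ Finset.univ) => h3 a)
  rw [h1, h2, ← Finset.mul_sum] at h4
  exact le_of_mul_le_mul_left h4 (by positivity)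

/-- With `N = ballBound D r`, at most `N` balls contain the site of `k`, and each contains at most
`2N` modes, weighted by `1/2`. The bound is independent of `n`. -/
theorem IsMajorana.sum_norm_antisymmPart_le (hγ : IsMajorana γ) {site : Fin n → Fin D → ℤ}
    (hsite : Function.Injective site) {r : ℝ}
    (hloc : GeometricallyLocal γ site 1 r (quadratic γ h)) (k : Fin (2 * n)) :
    ∑ j, ‖antisymmPart h k j‖ ≤ (ballBound D r : ℝ) ^ 2 := by
  classical
  refine (Finset.sum_le_sum fun j _ => hγ.norm_antisymmPart_le hloc k j).trans ?_
  rw [Finset.sum_comm]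
  have h1 : ∀ a, ∑ j, (if latticeDist (site a) (site (siteIndex k)) ≤ r then
      (if latticeDist (site a) (site (siteIndex j)) ≤ r then (1 / 2 : ℝ) else 0) else 0)
      ≤ if latticeDist (site (siteIndex k)) (site a) ≤ r then (ballBound D r : ℝ) else 0 := by
    intro a
    rw [latticeDist_comm (site (siteIndex k))]
    split_ifs with hk
    · rw [← Finset.sum_filter, Finset.sum_const, nsmul_eq_mul]
      have h2 := (card_modes_le {b | latticeDist (site a) (site b) ≤ r}).trans
        (Nat.mul_le_mul_left 2 (card_ball_le hsite r (site a)))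
      simp only [Set.mem_ofPred_eq] at h2
      have h3 : ((Finset.univ.filter fun j : Fin (2 * n) =>
          latticeDist (site a) (site (siteIndex j)) ≤ r).card : ℝ) ≤ 2 * ballBound D r := by
        exact_mod_cast h2
      linarith
    · simp
  refine (Finset.sum_le_sum fun a _ => h1 a).trans ?_
  rw [← Finset.sum_filter, Finset.sum_const, nsmul_eq_mul, pow_two]
  exact mul_le_mul_of_nonneg_right
    (by exact_mod_cast card_ball_le hsite r (site (siteIndex k))) (Nat.cast_nonneg _)

theorem IsMajorana.abs_energy_le (hγ : IsMajorana γ) {site : Fin n → Fin D → ℤ}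
    (hsite : Function.Injective site) {r : ℝ}
    (hloc : GeometricallyLocal γ site 1 r (quadratic γ h)) {e : ℝ}
    (he : IsSingleParticleEnergy h e) : |e| ≤ (ballBound D r : ℝ) ^ 2 := by
  have he' : Module.End.HasEigenvalue (Matrix.toLin' (antisymmPart h)) (e : ℂ) := he
  -- Gershgorin's theorem; the discs are centred at `0` since an antisymmetric matrix has zero
  -- diagonal.
  obtain ⟨k, hk⟩ := eigenvalue_mem_ball he'
  have h0 : antisymmPart h k k = 0 := by rw [antisymmPart_apply, sub_self, mul_zero]
  rw [h0, mem_closedBall_zero_iff, Complex.norm_real, Real.norm_eq_abs] at hk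
  refine hk.trans ((Finset.sum_le_sum_of_subset_of_nonneg (Finset.subset_univ _)
    fun j _ _ => norm_nonneg _).trans (hγ.sum_norm_antisymmPart_le hsite hloc k))

theorem isSingleParticleEnergy_iff (hA : (antisymmPart h).IsHermitian) (e : ℝ) :
    IsSingleParticleEnergy h e ↔ ∃ k, hA.eigenvalues k = e := by
  change Module.End.HasEigenvalue (Matrix.toLin' (antisymmPart h)) (e : ℂ) ↔ _
  rw [Module.End.hasEigenvalue_iff_mem_spectrum, Matrix.spectrum_toLin',
    hA.spectrum_eq_image_range]
  simp

theorem modeGap_eq (β ε : ℝ) :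
    modeGap β ε = singleModeGap (√2 * Real.exp (-1 / 4)) β ε := by
  rw [modeGap, rate, singleModeGap]
  ring

/-- The Gaussian is smallest at the largest energy, and `cosh` is at least `1`. -/
theorem le_modeGap {β e N : ℝ} (he : |e| ≤ N) :
    √2 * Real.exp (-1 / 4) * Real.exp (-4 * β ^ 2 * N ^ 2) ≤ modeGap β e := by
  rw [modeGap_eq, singleModeGap]
  have h1 : e ^ 2 ≤ N ^ 2 := sq_le_sq' (abs_le.1 he).1 (abs_le.1 he).2
  have h2 : Real.exp (-4 * β ^ 2 * N ^ 2) ≤ Real.exp (-4 * β ^ 2 * e ^ 2) := by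
    rw [Real.exp_le_exp]
    nlinarith [sq_nonneg β]
  have h3 := Real.one_le_cosh (2 * β * e)
  calc _ ≤ √2 * Real.exp (-1 / 4) * Real.exp (-4 * β ^ 2 * e ^ 2) :=
        mul_le_mul_of_nonneg_left h2 (by positivity)
    _ ≤ _ := le_mul_of_one_le_right (by positivity) h3

end Locality

end FreeFermion

end

/-! ### Proof of the proposition -/

theorem mainTheorem6 :
    ∃ C : ℝ, 0 < C ∧ ∀ (D : ℕ) (β r₀ : ℝ), 0 < β → 0 < r₀ →
      ∃ Δ : ℝ, 0 < Δ ∧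
        ∀ (n : ℕ) (site : Fin n → Fin D → ℤ), Function.Injective site →
        ∀ γ : Fin (2 * n) → FreeFermion.Op n, FreeFermion.IsMajorana γ →
        ∀ h : Matrix (Fin (2 * n)) (Fin (2 * n)) ℂ,
          IsSelfAdjoint (FreeFermion.quadratic γ h) →
          FreeFermion.GeometricallyLocal γ site 1 r₀ (FreeFermion.quadratic γ h) →
          IsSelfAdjoint (FreeFermion.freeParent γ β h) ∧
          Module.finrank ℂ
            (Module.End.eigenspace (FreeFermion.freeParent γ β h).toLinearMap 0) = 1 ∧
          (∀ μ : ℂ, Module.End.HasEigenvalue (FreeFermion.freeParent γ β h).toLinearMap μ →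
            μ ≠ 0 → μ.im = 0 ∧ μ.re ≤ -Δ) ∧
          (0 < n → ∃ g : ℝ,
            IsLeast {x : ℝ | ∃ ε : ℝ, FreeFermion.IsSingleParticleEnergy h ε ∧
              x = FreeFermion.singleModeGap C β ε} g ∧
            IsGreatest {μ : ℝ | μ ≠ 0 ∧
              Module.End.HasEigenvalue (FreeFermion.freeParent γ β h).toLinearMap (μ : ℂ)} (-g)) := by
  -- `C` is twice the prefactor `√2/2 * exp(-1/4)` of `rate`. `Δ` is the lower bound of `le_modeGap`
  -- for energies of size at most `(ballBound D r₀)²`.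
  refine ⟨√2 * Real.exp (-1 / 4), by positivity, fun D β r₀ hβ _ =>
    ⟨√2 * Real.exp (-1 / 4) *
      Real.exp (-4 * β ^ 2 * ((FreeFermion.ballBound D r₀ : ℝ) ^ 2) ^ 2), by positivity, ?_⟩⟩
  intro n site hsite γ hγ h hK hloc
  have hA := hγ.antisymmPart_isHermitian hK
  have hU := hγ.isModeMatrix hA
  have hcar := hU.isCAR hγ β
  have hH : FreeFermion.freeParent γ β h = _ := hU.parentHamiltonian_eq hγ hK hβ
  have hpos : ∀ k, 0 < FreeFermion.modeGap β (hA.eigenvalues k) := fun k =>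
    FreeFermion.modeGap_pos _ _
  have hdim : Module.finrank ℂ (FreeFermion.Fock' n) = 2 ^ Fintype.card (Fin (2 * n)) := by
    rw [FreeFermion.finrank_fock, Fintype.card_fin]
  have henergy := FreeFermion.isSingleParticleEnergy_iff hA
  rw [hH]
  refine ⟨FreeFermion.carHamiltonian_isSelfAdjoint _, ?_, fun μ hμ h0 => ?_, fun hn => ?_⟩
  · rw [FreeFermion.eigenspace_carHamiltonian hpos]
    exact hcar.finrank_vacuumSpace_univ hdim
  · obtain ⟨him, k, hk⟩ := hcar.exists_eigenvalue_le hpos hμ h0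
    refine ⟨him, hk.trans (neg_le_neg (FreeFermion.le_modeGap ?_))⟩
    exact hγ.abs_energy_le hsite hloc ((henergy _).2 ⟨k, rfl⟩)
  · have : Nonempty (Fin (2 * n)) := ⟨⟨0, by omega⟩⟩
    -- The mode of least gap serves both claims: its one-particle state attains the eigenvalue, and
    -- any nonzero eigenvalue lies below minus some mode gap.
    obtain ⟨k, hk⟩ := Finite.exists_min fun k => FreeFermion.modeGap β (hA.eigenvalues k)
    refine ⟨FreeFermion.modeGap β (hA.eigenvalues k), ⟨⟨hA.eigenvalues k, (henergy _).2 ⟨k, rfl⟩,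
      FreeFermion.modeGap_eq _ _⟩, ?_⟩, ⟨(neg_lt_zero.2 (hpos k)).ne,
        hcar.hasEigenvalue hdim _ k⟩, ?_⟩
    · rintro _ ⟨e, he, rfl⟩
      obtain ⟨l, rfl⟩ := (henergy e).1 he
      rw [← FreeFermion.modeGap_eq]
      exact hk l
    · rintro μ ⟨h0, hμ⟩
      obtain ⟨-, l, hl⟩ := hcar.exists_eigenvalue_le hpos hμ (by exact_mod_cast h0)
      rw [Complex.ofReal_re] at hl
      exact hl.trans (neg_le_neg (hk l))
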